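/- Let $c$ be Euler's constant. The Titchmarsh–Kober–Atkinson constant $c_0$ is the constant term in the expansion of $\int_0^\infty|\zeta(\tfrac12+it)|^2e^{-2\delta t}\,dt-\frac{c-\ln(4\pi\delta)}{2\sin\delta}$ as $\delta\to0^+$, that is, $$c_0=\lim_{\delta\to0^+}\left[\int_0^\infty\left|\zeta\left(\tfrac12+it\right)\right|^2e^{-2\delta t}\,dt-\frac{c-\ln(4\pi\delta)}{2\sin\delta}\right].$$ Let $y_0>1$ and let $\mu:[y_0,\infty)\to\mathbb{R}$ be a continuous nondecreasing function with $\mu(y)\ge 7y\ln y$ for all $y\ge y_0$. For all sufficiently large $T$ let $\varphi(T)$ be the solution $y\ge y_0$ of $$\int_0^{\mu(y)}\left|\zeta\left(\tfrac12+it\right)\right|^2e^{-2t/y}\,dt=\int_0^T\left|\zeta\left(\tfrac12+it\right)\right|^2dt,$$ and let $\varphi_1=\tfrac12\varphi$ (the Jacob's ladder). Define the reverse iterates by $\overset{0}{T}=T$ and $\overset{r}{T}=\varphi_1^{-1}(\overset{r-1}{T})$, so that $\varphi_1(\overset{r}{T})=\overset{r-1}{T}$. For $X>0$ put $$(0,X]^+=\{t\in(0,X]:\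 \ln t>|\zeta(\tfrac12+it)|^2\},\qquad (0,X]^-=\{t\in(0,X]:\ \ln t\le|\zeta(\tfrac12+it)|^2\}.$$ **Theorem 2.** The limit $c_0$ exists. For every fixed $k\in\mathbb{N}$ the reverse iterates $\overset{1}{T},\dots,\overset{k}{T}$ are defined, with $\varphi_1(\overset{r}{T})=\overset{r-1}{T}$, for all sufficiently large $T$, and for $r=1,\dots,k$ $$\lim_{T\to\infty}\left[\int_{(0,\overset{r-1}{T}]^+}\left\{\ln t-\left|\zeta\left(\tfrac12+it\right)\right|^2\right\}dt-\int_{(0,\overset{r-1}{T}]^-}\left\{-\ln t+\left|\zeta\left(\tfrac12+it\right)\right|^2\right\}dt-\int_{\overset{r-1}{T}}^{\overset{r}{T}}\left|\zeta\left(\tfrac12+it\right)\right|^2dt-(\ln2\pi-1-c)\,\overset{r-1}{T}\right]=-c_0.$$ -/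

import Mathlib

open MeasureTheory Set Filter Topology

namespace JacobLadder

noncomputable section

/-- The function `|ζ(1/2 + it)|²` of the real variable `t`. -/
def zetaSq (t : ℝ) : ℝ := ‖riemannZeta (1 / 2 + (t : ℂ) * Complex.I)‖ ^ 2

/-- The Hardy-Littlewood integral `J(T) = ∫_0^T |ζ(1/2 + it)|² dt`. -/
def hardyLittlewood (T : ℝ) : ℝ := ∫ t in (0 : ℝ)..T, zetaSq t

/-- `c₀` is the Titchmarsh-Kober-Atkinson constant: the constant term `c₀` of the formula
`∫_0^∞ |ζ(1/2 + it)|² e^{-2δt} dt = (c - ln(4πδ)) / (2 sin δ) + c₀ + c₁ δ + ⋯` as `δ → 0+`,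
where `c` is Euler's constant. -/
def IsTitchmarshKoberAtkinsonConstant (c₀ : ℝ) : Prop :=
  Tendsto (fun δ : ℝ => (∫ t in Ioi (0 : ℝ), zetaSq t * Real.exp (-(2 * δ * t)))
      - (Real.eulerMascheroniConstant - Real.log (4 * Real.pi * δ)) / (2 * Real.sin δ))
    (𝓝[>] 0) (𝓝 c₀)

/-- The admissible functions `μ` on `[y₀, ∞)`. -/
structure Admissible (μ : ℝ → ℝ) (y₀ : ℝ) : Prop where
  one_lt : 1 < y₀
  continuousOn : ContinuousOn μ (Ici y₀)
  monotoneOn : MonotoneOn μ (Ici y₀)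
  lower_bound : ∀ y ∈ Ici y₀, 7 * y * Real.log y ≤ μ y

/-- The left-hand side `∫_0^{μ(y)} |ζ(1/2 + it)|² e^{-2t/y} dt` of the equation that defines
the ladder. -/
def smoothed (μ : ℝ → ℝ) (y : ℝ) : ℝ :=
  ∫ t in (0 : ℝ)..(μ y), zetaSq t * Real.exp (-(2 / y * t))

/-- The set of `T` for which the equation
`∫_0^{μ(y)} |ζ(1/2 + it)|² e^{-2t/y} dt = ∫_0^T |ζ(1/2 + it)|² dt` has a solution `y ≥ y₀`. -/
def domain (μ : ℝ → ℝ) (y₀ : ℝ) : Set ℝ :=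
  {T | 0 ≤ T ∧ ∃ y ∈ Ici y₀, smoothed μ y = hardyLittlewood T}

/-- The solution `y = φ(T) ≥ y₀` of the equation
`∫_0^{μ(y)} |ζ(1/2 + it)|² e^{-2t/y} dt = ∫_0^T |ζ(1/2 + it)|² dt`, for `T` in `domain μ y₀`. -/
def phi (μ : ℝ → ℝ) (y₀ : ℝ) (T : ℝ) : ℝ :=
  Function.invFunOn (smoothed μ) (Ici y₀) (hardyLittlewood T)

/-- Jacob's ladder `φ₁ = φ / 2`. -/
def phiOne (μ : ℝ → ℝ) (y₀ : ℝ) (T : ℝ) : ℝ := phi μ y₀ T / 2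

/-- The inverse function `φ₁⁻¹` of Jacob's ladder. -/
def phiOneInv (μ : ℝ → ℝ) (y₀ : ℝ) : ℝ → ℝ :=
  Function.invFunOn (phiOne μ y₀) (domain μ y₀)

/-- The reverse iterates `T^r = φ₁^{-r}(T)` : `T^0 = T` and `T^{r+1} = φ₁⁻¹(T^r)`. -/
def revIter (μ : ℝ → ℝ) (y₀ : ℝ) : ℕ → ℝ → ℝ
  | 0, T => T
  | r + 1, T => phiOneInv μ y₀ (revIter μ y₀ r T)

/-- `(0, X]⁺`. -/
def plusSet (X : ℝ) : Set ℝ := {t | zetaSq t < Real.log t ∧ 0 < t ∧ t ≤ X}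

/-- `(0, X]⁻`. -/
def minusSet (X : ℝ) : Set ℝ := {t | Real.log t ≤ zetaSq t ∧ 0 < t ∧ t ≤ X}

end

end JacobLadder

namespace JacobLadder

noncomputable section

/-! Write J(T) for the integral of |ζ(1/2+it)|² over [0,T]. The difference of the plus and minus
integrals up to X is X ln X - X - J(X), and the integral from X to φ₁⁻¹(X) is J(φ₁⁻¹(X)) - J(X). The
terms J(X) cancel, and the equation defining the ladder turns J(φ₁⁻¹(X)) into `smoothed μ (2 * X)`
(`hardyLittlewood_phiOneInv`). The theorem is therefore the expansion of `smoothed` to its constant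
term, read at X = φ₁⁻ʳ⁺¹(T). Since μ(y) ≥ 7y ln y, truncating at μ(y) costs o(1), and what remains
is the Laplace transform of |ζ(1/2+it)|² at δ = 1/y. Its constant term is found explicitly: c₀ = π.

The Laplace transform is treated by Titchmarsh's method. The series D(z) = Σ d(n) e^{-nz} minus its
main term (c - log z)/z has Mellin transform Γ(s)ζ(s)² in 0 < Re s < 1
(`hasMellin_divisorRemainder`). Mellin inversion on Re s = 1/2, continued analytically in w = log z
to |Im w| < π/2, gives `gammaZetaTransform_eq`. At z = 2πi e^{-2iδ} the functional equation turns
the integrand into a constant times |ζ|² e^{-2δt}/(1 + i e^{-πt}). Taking real parts and folding t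
to -t leaves the Laplace transform plus an error tending to 0 (`integral_zetaSq_mul_exp_add`).

On the other side, D has period 2πi, so z may be replaced by u - iv with u = 2π sin 2δ and v = 4π
sin²δ. Since v = O(δ²), moment bounds reduce D to its value at u, where D(u) = (c - log u)/u + 1/4 +
o(1) (`tendsto_realDivisorSeries_sub`). The factor 2π cos δ turns 1/4 into π/2; the subtracted main
term at 2πi contributes another π/2.

The expansion of D(u) comes from splitting 1/(e^x - 1) into e^{-x}/x, which sums to a logarithm, and
a convex function with integral c and value 1/2 at 0, to which a first-order Euler-Maclaurin formula
for convex functions applies. -/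

/-! ### Riemann sums of convex functions -/

/-- Upper half of the Hermite-Hadamard inequality. -/
lemma integral_le_average_of_convexOn {G : ℝ → ℝ} {a b : ℝ} (hab : a ≤ b)
    (hG : ConvexOn ℝ (Icc a b) G) (hc : ContinuousOn G (Icc a b)) :
    ∫ x in a..b, G x ≤ (b - a) * ((G a + G b) / 2) := by
  rcases hab.eq_or_lt with rfl | hlt
  · simp
  have hpos : 0 < b - a := sub_pos.2 hlt
  have h1 : ∫ x in a..b, G x ≤ ∫ x in a..b, ((b - x) / (b - a) * G a + (x - a) / (b - a) * G b) := by
    refine intervalIntegral.integral_mono_on hab (hc.intervalIntegrable_of_Icc hab)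
      (Continuous.intervalIntegrable (by fun_prop) _ _) fun x hx => ?_
    have := hG.2 (left_mem_Icc.2 hab) (right_mem_Icc.2 hab)
      (show 0 ≤ (b - x) / (b - a) from div_nonneg (by linarith [hx.2]) hpos.le)
      (show 0 ≤ (x - a) / (b - a) from div_nonneg (by linarith [hx.1]) hpos.le)
      (by field_simp; ring)
    have e : ((b - x) / (b - a)) • a + ((x - a) / (b - a)) • b = x := by
      simp only [smul_eq_mul]; field_simp; ring
    rw [e] at this
    simpa using this
  refine h1.trans (le_of_eq ?_)
  rw [intervalIntegral.integral_add (Continuous.intervalIntegrable (by fun_prop) _ _)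
    (Continuous.intervalIntegrable (by fun_prop) _ _)]
  simp only [intervalIntegral.integral_mul_const, intervalIntegral.integral_div]
  rw [intervalIntegral.integral_sub (by simp) (by simp),
    intervalIntegral.integral_sub (by simp) (by simp)]
  simp only [intervalIntegral.integral_const, integral_id, smul_eq_mul]
  field_simp
  ring

/-- Lower half of the Hermite-Hadamard inequality. -/
lemma midpoint_le_integral_of_convexOn {G : ℝ → ℝ} {m h : ℝ} (hh : 0 ≤ h)
    (hG : ConvexOn ℝ (Icc (m - h) (m + h)) G) (hc : ContinuousOn G (Icc (m - h) (m + h))) :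
    2 * h * G m ≤ ∫ x in (m - h)..(m + h), G x := by
  have hi1 : IntervalIntegrable G volume (m - h) m :=
    (hc.mono (Icc_subset_Icc le_rfl (by linarith))).intervalIntegrable_of_Icc (by linarith)
  have hi2 : IntervalIntegrable G volume m (m + h) :=
    (hc.mono (Icc_subset_Icc (by linarith) le_rfl)).intervalIntegrable_of_Icc (by linarith)
  rw [← intervalIntegral.integral_add_adjacent_intervals hi1 hi2]
  have e1 : ∫ x in (m - h)..m, G x = ∫ t in (0 : ℝ)..h, G (m - t) := by
    rw [intervalIntegral.integral_comp_sub_left]; simp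
  have e2 : ∫ x in m..(m + h), G x = ∫ t in (0 : ℝ)..h, G (m + t) := by
    rw [intervalIntegral.integral_comp_add_left]; simp
  have c1 : ContinuousOn (fun t => G (m - t)) (Icc 0 h) :=
    hc.comp (by fun_prop) fun t ht => ⟨by linarith [ht.2], by linarith [ht.1]⟩
  have c2 : ContinuousOn (fun t => G (m + t)) (Icc 0 h) :=
    hc.comp (by fun_prop) fun t ht => ⟨by linarith [ht.1], by linarith [ht.2]⟩
  rw [e1, e2, ← intervalIntegral.integral_add (c1.intervalIntegrable_of_Icc hh)
    (c2.intervalIntegrable_of_Icc hh)]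
  have : ∫ t in (0 : ℝ)..h, 2 * G m ≤ ∫ t in (0 : ℝ)..h, (G (m - t) + G (m + t)) := by
    refine intervalIntegral.integral_mono_on hh (by simp)
      ((c1.add c2).intervalIntegrable_of_Icc hh) fun t ht => ?_
    have := hG.2 (show m - t ∈ Icc (m - h) (m + h) from ⟨by linarith [ht.2], by linarith [ht.1]⟩)
      (show m + t ∈ Icc (m - h) (m + h) from ⟨by linarith [ht.1], by linarith [ht.2]⟩)
      (show (0 : ℝ) ≤ 1 / 2 by norm_num) (show (0 : ℝ) ≤ 1 / 2 by norm_num) (by norm_num)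
    have e : (1 / 2 : ℝ) • (m - t) + (1 / 2 : ℝ) • (m + t) = m := by
      simp only [smul_eq_mul]; ring
    rw [e] at this
    simp only [smul_eq_mul] at this
    linarith
  rw [intervalIntegral.integral_const, smul_eq_mul] at this
  linarith

section RiemannSum

variable {g : ℝ → ℝ}

/-- Each sample point is the midpoint of an interval of length u, and these intervals tile the range
of integration, so the midpoint inequality adds up. -/
lemma sum_mul_le_integral (hg : ConvexOn ℝ (Ici 0) g) (hc : ContinuousOn g (Ici 0)) {u : ℝ}
    (hu : 0 < u) (N : ℕ) :
    ∑ m ∈ Finset.range N, u * g ((m + 1) * u) ≤ ∫ x in (u / 2)..((N + 1 / 2) * u), g x := by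
  induction N with
  | zero => simp [div_eq_inv_mul]
  | succ N ih =>
    have hi : ∀ a b : ℝ, 0 ≤ a → a ≤ b → IntervalIntegrable g volume a b := fun a b ha hab =>
      (hc.mono fun x hx => ha.trans hx.1).intervalIntegrable_of_Icc hab
    have hN : (0 : ℝ) ≤ N := N.cast_nonneg
    rw [Finset.sum_range_succ, ← intervalIntegral.integral_add_adjacent_intervals
      (hi (u / 2) ((N + 1 / 2) * u) (by positivity) (by nlinarith))
      (hi ((N + 1 / 2) * u) (((N + 1 : ℕ) + 1 / 2) * u) (by positivity) (by push_cast; nlinarith))]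
    refine add_le_add ih ?_
    have hsub : Icc ((N + 1) * u - u / 2) ((N + 1) * u + u / 2) ⊆ Ici (0 : ℝ) := fun x hx =>
      le_trans (by nlinarith) hx.1
    have := midpoint_le_integral_of_convexOn (m := (N + 1) * u) (h := u / 2) (by positivity)
      (hg.subset hsub (convex_Icc _ _)) (hc.mono hsub)
    convert! this using 2 <;> push_cast <;> ring

/-- This is the trapezoid rule on each interval [mu, (m+1)u], which overestimates the integral of a
convex function; the two endpoints carry weight 1/2. -/
lemma integral_le_sum_mul (hg : ConvexOn ℝ (Ici 0) g) (hc : ContinuousOn g (Ici 0)) {u : ℝ}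
    (hu : 0 < u) (N : ℕ) :
    (∫ x in (0 : ℝ)..(N * u), g x) + u * g (N * u) / 2 ≤
      u * g 0 / 2 + ∑ m ∈ Finset.range N, u * g ((m + 1) * u) := by
  induction N with
  | zero => simp
  | succ N ih =>
    have hi : ∀ a b : ℝ, 0 ≤ a → a ≤ b → IntervalIntegrable g volume a b := fun a b ha hab =>
      (hc.mono fun x hx => ha.trans hx.1).intervalIntegrable_of_Icc hab
    have hN : (0 : ℝ) ≤ N := N.cast_nonneg
    rw [Finset.sum_range_succ, ← intervalIntegral.integral_add_adjacent_intervals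
      (hi 0 (N * u) le_rfl (by positivity))
      (hi (N * u) ((N + 1 : ℕ) * u) (by positivity) (by push_cast; nlinarith))]
    have hsub : Icc (N * u) ((N + 1) * u) ⊆ Ici (0 : ℝ) := fun x hx =>
      le_trans (by positivity) hx.1
    have := integral_le_average_of_convexOn (a := N * u) (b := (N + 1) * u) (by nlinarith)
      (hg.subset hsub (convex_Icc _ _)) (hc.mono hsub)
    push_cast
    linarith

lemma summable_samples (hg : ConvexOn ℝ (Ici 0) g) (hc : ContinuousOn g (Ici 0))
    (h0 : ∀ x, 0 ≤ x → 0 ≤ g x) (hi : IntegrableOn g (Ioi 0)) {u : ℝ} (hu : 0 < u) : Summable fun m : ℕ => g ((m + 1) * u) := by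
  have : Summable fun m : ℕ => u * g ((m + 1) * u) := by
    refine summable_of_sum_range_le (c := ∫ x in Ioi 0, g x)
      (fun n => mul_nonneg hu.le (h0 _ (by positivity))) fun N => ?_
    refine (sum_mul_le_integral hg hc hu N).trans ?_
    rw [intervalIntegral.integral_of_le (by nlinarith [(N.cast_nonneg : (0 : ℝ) ≤ N)])]
    exact setIntegral_mono_set hi ((ae_restrict_iff' measurableSet_Ioi).2
      (ae_of_all _ fun x hx => h0 x (le_of_lt hx)))
      (LE.le.eventuallyLE fun x hx => lt_trans (by positivity) hx.1)
  simpa [hu.ne'] using this.mul_left u⁻¹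

lemma samples_le (hg : ConvexOn ℝ (Ici 0) g) (hc : ContinuousOn g (Ici 0))
    (h0 : ∀ x, 0 ≤ x → 0 ≤ g x) (hi : IntegrableOn g (Ioi 0)) {u : ℝ} (hu : 0 < u) :
    u * ∑' m : ℕ, g ((m + 1) * u) ≤ ∫ x in Ioi (u / 2), g x := by
  rw [← tsum_mul_left]
  have h1 := ((summable_samples hg hc h0 hi hu).mul_left u).hasSum.tendsto_sum_nat
  have h2 : Tendsto (fun N : ℕ => ((N : ℝ) + 1 / 2) * u) atTop atTop :=
    (tendsto_atTop_add_const_right _ _ tendsto_natCast_atTop_atTop).atTop_mul_const hu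
  have h3 := intervalIntegral_tendsto_integral_Ioi (u / 2)
    (hi.mono_set (Ioi_subset_Ioi (by positivity : 0 ≤ u / 2))) h2
  exact le_of_tendsto_of_tendsto' h1 h3 fun N => sum_mul_le_integral hg hc hu N

lemma le_samples (hg : ConvexOn ℝ (Ici 0) g) (hc : ContinuousOn g (Ici 0))
    (h0 : ∀ x, 0 ≤ x → 0 ≤ g x) (hi : IntegrableOn g (Ioi 0)) {u : ℝ} (hu : 0 < u) :
    ∫ x in Ioi 0, g x ≤ u * g 0 / 2 + u * ∑' m : ℕ, g ((m + 1) * u) := by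
  rw [← tsum_mul_left]
  have h1 := ((summable_samples hg hc h0 hi hu).mul_left u).hasSum.tendsto_sum_nat
  have h2 : Tendsto (fun N : ℕ => (N : ℝ) * u) atTop atTop :=
    tendsto_natCast_atTop_atTop.atTop_mul_const hu
  have h3 := intervalIntegral_tendsto_integral_Ioi 0 hi h2
  refine le_of_tendsto_of_tendsto' h3 (h1.const_add _) fun N => ?_
  have := integral_le_sum_mul hg hc hu N
  have := h0 (N * u) (by positivity)
  nlinarith

/-- The first Euler-Maclaurin correction of a convex function. -/
lemma tendsto_samples_sub_integral (hg : ConvexOn ℝ (Ici 0) g) (hc : ContinuousOn g (Ici 0))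
    (h0 : ∀ x, 0 ≤ x → 0 ≤ g x) (hi : IntegrableOn g (Ioi 0)) :
    Tendsto (fun u : ℝ => ∑' m : ℕ, g ((m + 1) * u) - (∫ x in Ioi 0, g x) / u) (𝓝[>] 0)
      (𝓝 (-(g 0 / 2))) := by
  -- The trapezoid rule bounds the difference below by exactly -g(0)/2. The midpoint rule bounds it
  -- above by -(1/u) times the integral of g over [0, u/2], which has the same limit because it is
  -- half an average of g near 0.
  have hlim : Tendsto (fun u : ℝ => -((2 : ℝ)⁻¹ * ((u / 2)⁻¹ * ∫ x in (0 : ℝ)..(u / 2), g x)))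
      (𝓝[>] 0) (𝓝 (-(g 0 / 2))) := by
    have hd : HasDerivWithinAt (fun v => ∫ x in (0 : ℝ)..v, g x) (g 0) (Ici 0) 0 := by
      refine intervalIntegral.integral_hasDerivWithinAt_right (by simp)
        (t := Ioi 0) ?_ ((hc 0 self_mem_Ici).mono Ioi_subset_Ici_self)
      exact ⟨Ioi 0, self_mem_nhdsWithin, hi.1⟩
    have h1 := (hasDerivWithinAt_iff_tendsto_slope' (by simp)).1 (hd.mono Ioi_subset_Ici_self)
    have h2 : Tendsto (fun u : ℝ => u / 2) (𝓝[>] 0) (𝓝[>] 0) := by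
      refine tendsto_nhdsWithin_iff.2 ⟨?_, ?_⟩
      · exact ((continuous_id.div_const 2).tendsto' 0 0 (by simp)).mono_left nhdsWithin_le_nhds
      · filter_upwards [self_mem_nhdsWithin] with u hu
        exact half_pos (mem_Ioi.1 hu)
    have h3 := ((h1.comp h2).const_mul 2⁻¹).neg
    convert! h3 using 2
    · simp [slope]
    · ring
  refine tendsto_of_tendsto_of_tendsto_of_le_of_le' tendsto_const_nhds hlim ?_ ?_
  · filter_upwards [self_mem_nhdsWithin] with u hu
    have hu : 0 < u := hu
    have := le_samples hg hc h0 hi hu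
    rw [le_sub_iff_add_le, ← le_sub_iff_add_le', div_le_iff₀ hu]
    linarith
  · filter_upwards [self_mem_nhdsWithin] with u hu
    have hu : 0 < u := hu
    have h1 := samples_le hg hc h0 hi hu
    have h2 : (∫ x in (0 : ℝ)..(u / 2), g x) + ∫ x in Ioi (u / 2), g x = ∫ x in Ioi 0, g x :=
      intervalIntegral.integral_interval_add_Ioi hi
        (hi.mono_set (Ioi_subset_Ioi (by positivity : 0 ≤ u / 2)))
    rw [← h2]
    have : (2 : ℝ)⁻¹ * ((u / 2)⁻¹ * ∫ x in (0 : ℝ)..(u / 2), g x) =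
      (∫ x in (0 : ℝ)..(u / 2), g x) / u := by field_simp
    rw [this, sub_le_iff_le_add, ← neg_div, ← add_div, le_div_iff₀ hu]
    linarith

end RiemannSum

/-! ### The Planck defect and Euler's constant -/

/-- The function `(e^x - 1) / x`, as an integral. -/
def expSlope (x : ℝ) : ℝ := ∫ v in (0 : ℝ)..1, Real.exp (v * x)

/-- The function `(e^{-x} - 1 + x) / x²`, as an integral. -/
def expRemainder (x : ℝ) : ℝ := ∫ v in (0 : ℝ)..1, (1 - v) * Real.exp (-(v * x))

/-- The convex function `1 / (e^x - 1) - e^{-x} / x`, with its removable singularity removed. -/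
def planckDefect (x : ℝ) : ℝ := (expSlope x)⁻¹ * expRemainder x

lemma expSlope_eq {x : ℝ} (hx : x ≠ 0) : expSlope x = (Real.exp x - 1) / x := by
  unfold expSlope
  rw [intervalIntegral.integral_comp_mul_right (fun y => Real.exp y) hx]
  simp [integral_exp, div_eq_inv_mul]

lemma expSlope_pos (x : ℝ) : 0 < expSlope x := by
  refine intervalIntegral.intervalIntegral_pos_of_pos
    (Continuous.intervalIntegrable (by fun_prop) _ _) (fun v => Real.exp_pos _) one_pos

lemma continuous_expSlope : Continuous expSlope :=
  intervalIntegral.continuous_parametric_intervalIntegral_of_continuous' (by fun_prop) _ _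

lemma continuous_expRemainder : Continuous expRemainder :=
  intervalIntegral.continuous_parametric_intervalIntegral_of_continuous' (by fun_prop) _ _

lemma expSlope_monotone : Monotone expSlope := fun x y hxy => by
  refine intervalIntegral.integral_mono_on zero_le_one
    (Continuous.intervalIntegrable (by fun_prop) _ _)
    (Continuous.intervalIntegrable (by fun_prop) _ _) fun v hv => ?_
  exact Real.exp_le_exp.2 (mul_le_mul_of_nonneg_left hxy hv.1)

lemma expRemainder_nonneg (x : ℝ) : 0 ≤ expRemainder x :=
  intervalIntegral.integral_nonneg zero_le_one fun v hv =>
    mul_nonneg (by linarith [hv.2]) (Real.exp_pos _).le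

lemma expRemainder_antitone : Antitone expRemainder := fun x y hxy => by
  refine intervalIntegral.integral_mono_on zero_le_one
    (Continuous.intervalIntegrable (by fun_prop) _ _)
    (Continuous.intervalIntegrable (by fun_prop) _ _) fun v hv => ?_
  exact mul_le_mul_of_nonneg_left
    (Real.exp_le_exp.2 (neg_le_neg (mul_le_mul_of_nonneg_left hxy hv.1))) (by linarith [hv.2])

lemma expRemainder_convexOn : ConvexOn ℝ univ expRemainder := by
  refine ⟨convex_univ, fun x _ y _ a b ha hb hab => ?_⟩
  unfold expRemainder
  simp only [smul_eq_mul]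
  rw [← intervalIntegral.integral_const_mul,
    ← intervalIntegral.integral_const_mul, ← intervalIntegral.integral_add
    (Continuous.intervalIntegrable (by fun_prop) _ _)
    (Continuous.intervalIntegrable (by fun_prop) _ _)]
  refine intervalIntegral.integral_mono_on zero_le_one
    (Continuous.intervalIntegrable (by fun_prop) _ _)
    (Continuous.intervalIntegrable (by fun_prop) _ _) fun v hv => ?_
  have := convexOn_exp.2 (mem_univ (-(v * x))) (mem_univ (-(v * y))) ha hb hab
  simp only [smul_eq_mul] at this ⊢
  have h2 := mul_le_mul_of_nonneg_left this (show 0 ≤ 1 - v by linarith [hv.2])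
  refine le_trans (le_of_eq ?_) (h2.trans (le_of_eq (by ring)))
  congr 2
  ring

lemma expRemainder_zero : expRemainder 0 = 1 / 2 := by
  unfold expRemainder
  simp only [mul_zero, neg_zero, Real.exp_zero, mul_one]
  rw [intervalIntegral.integral_sub (by simp) (by simp)]
  simp
  norm_num

lemma expSlope_zero : expSlope 0 = 1 := by simp [expSlope]

lemma expRemainder_eq {x : ℝ} (hx : x ≠ 0) :
    expRemainder x = (Real.exp (-x) - 1 + x) / x ^ 2 := by
  have hd : ∀ v ∈ uIcc (0 : ℝ) 1, HasDerivAt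
      (fun v => (-(1 - v) / x + 1 / x ^ 2) * Real.exp (-(v * x)))
      ((1 - v) * Real.exp (-(v * x))) v := by
    intro v _
    have h1 : HasDerivAt (fun v : ℝ => -(1 - v) / x + 1 / x ^ 2) (1 / x) v := by
      have := ((((hasDerivAt_id v).const_sub 1).neg).div_const x).add_const (1 / x ^ 2)
      simpa using this
    have h2 : HasDerivAt (fun v : ℝ => Real.exp (-(v * x))) (Real.exp (-(v * x)) * (-x)) v := by
      have := (((hasDerivAt_id v).mul_const x).neg).exp
      simpa using this
    convert! h1.mul h2 using 1
    field_simp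
    ring
  unfold expRemainder
  rw [intervalIntegral.integral_eq_sub_of_hasDerivAt hd
    (Continuous.intervalIntegrable (by fun_prop) _ _)]
  simp
  field_simp
  ring

lemma planckDefect_eq {x : ℝ} (hx : 0 < x) :
    planckDefect x = 1 / (Real.exp x - 1) - Real.exp (-x) / x := by
  have h1 : 0 < Real.exp x - 1 := by linarith [Real.add_one_lt_exp hx.ne']
  rw [planckDefect, expSlope_eq hx.ne', expRemainder_eq hx.ne', Real.exp_neg]
  have := Real.exp_pos x
  field_simp
  ring

lemma planckDefect_zero : planckDefect 0 = 1 / 2 := by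
  simp [planckDefect, expSlope_zero, expRemainder_zero]

lemma continuous_planckDefect : Continuous planckDefect :=
  (continuous_expSlope.inv₀ fun x => (expSlope_pos x).ne').mul continuous_expRemainder

lemma planckDefect_nonneg (x : ℝ) : 0 ≤ planckDefect x :=
  mul_nonneg (inv_nonneg.2 (expSlope_pos x).le) (expRemainder_nonneg x)

/-- This is the factor that decides the sign of the second derivative of x/(e^x - 1). It vanishes at
0, and its derivative (x-1)e^x + 1 is nonnegative because 1 - x ≤ e^{-x}. -/
lemma sub_two_mul_exp_add_nonneg {x : ℝ} (hx : 0 ≤ x) : 0 ≤ (x - 2) * Real.exp x + x + 2 := by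
  have hd : ∀ x : ℝ, HasDerivAt (fun x => (x - 2) * Real.exp x + x + 2)
      ((x - 1) * Real.exp x + 1) x := fun x => by
    have := ((((hasDerivAt_id x).sub_const 2).mul (Real.hasDerivAt_exp x)).add
      (hasDerivAt_id x)).add_const 2
    convert! this using 1
    simp
    ring
  have hm : MonotoneOn (fun x : ℝ => (x - 2) * Real.exp x + x + 2) (Ici 0) := by
    refine monotoneOn_of_deriv_nonneg (convex_Ici 0) (by fun_prop) (by fun_prop) fun y hy => ?_
    rw [(hd y).deriv]
    have h1 := Real.add_one_le_exp (-y)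
    have h2 : Real.exp (-y) * Real.exp y = 1 := by rw [← Real.exp_add]; simp
    nlinarith [Real.exp_pos y]
  simpa using hm self_mem_Ici hx hx

lemma convexOn_inv_expSlope : ConvexOn ℝ (Ici 0) fun x => (expSlope x)⁻¹ := by
  have heq : ∀ x : ℝ, 0 < x → (fun x => (expSlope x)⁻¹) =ᶠ[𝓝 x] fun x => x / (Real.exp x - 1) := by
    intro x hx
    filter_upwards [lt_mem_nhds hx] with y hy
    rw [expSlope_eq hy.ne', inv_div]
  have hE : ∀ x : ℝ, 0 < x → 0 < Real.exp x - 1 := fun x hx => by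
    linarith [Real.add_one_lt_exp hx.ne']
  have hd1 : ∀ x : ℝ, 0 < x → HasDerivAt (fun x => (expSlope x)⁻¹)
      (((Real.exp x - 1) - x * Real.exp x) / (Real.exp x - 1) ^ 2) x := by
    intro x hx
    refine HasDerivAt.congr_of_eventuallyEq ?_ (heq x hx)
    have := (hasDerivAt_id x).div ((Real.hasDerivAt_exp x).sub_const 1) (hE x hx).ne'
    convert! this using 1
    simp
  have hd2 : ∀ x : ℝ, 0 < x → HasDerivAt
      (fun x => ((Real.exp x - 1) - x * Real.exp x) / (Real.exp x - 1) ^ 2)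
      (Real.exp x * ((x - 2) * Real.exp x + x + 2) / (Real.exp x - 1) ^ 3) x := by
    intro x hx
    have h0 := (hE x hx).ne'
    have := (((Real.hasDerivAt_exp x).sub_const 1).sub
      ((hasDerivAt_id x).mul (Real.hasDerivAt_exp x))).div
      (((Real.hasDerivAt_exp x).sub_const 1).pow 2) (pow_ne_zero 2 h0)
    convert! this using 1
    simp
    field_simp
    ring
  have hder : ∀ x : ℝ, 0 < x → deriv (fun x => (expSlope x)⁻¹) =ᶠ[𝓝 x]
      fun x => ((Real.exp x - 1) - x * Real.exp x) / (Real.exp x - 1) ^ 2 := by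
    intro x hx
    filter_upwards [lt_mem_nhds hx] with y hy using (hd1 y hy).deriv
  refine convexOn_of_deriv2_nonneg (convex_Ici 0)
    (continuous_expSlope.inv₀ fun x => (expSlope_pos x).ne').continuousOn ?_ ?_ ?_
  · intro x hx
    rw [interior_Ici] at hx
    exact (hd1 x hx).differentiableAt.differentiableWithinAt
  · intro x hx
    rw [interior_Ici] at hx
    exact ((hd2 x hx).congr_of_eventuallyEq (hder x hx)).differentiableAt.differentiableWithinAt
  · intro x hx
    rw [interior_Ici] at hx
    have hx : 0 < x := hx
    have : deriv^[2] (fun x => (expSlope x)⁻¹) x = _ :=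
      ((hd2 x hx).congr_of_eventuallyEq (hder x hx)).deriv
    rw [this]
    have := sub_two_mul_exp_add_nonneg hx.le
    have := hE x hx
    positivity

/-- Both factors are nonnegative, convex and decreasing, and a product of such functions is convex.
This is the reason for defining the defect as a product. -/
lemma planckDefect_convexOn : ConvexOn ℝ (Ici 0) planckDefect := by
  refine convexOn_inv_expSlope.mul (expRemainder_convexOn.subset (subset_univ _) (convex_Ici 0))
    (fun x _ => inv_nonneg.2 (expSlope_pos x).le) (fun x _ => expRemainder_nonneg x) ?_
  refine AntitoneOn.monovaryOn ?_ (expRemainder_antitone.antitoneOn _)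
  intro x _ y _ hxy
  exact inv_anti₀ (expSlope_pos x) (expSlope_monotone hxy)

lemma planckDefect_le_exp {x : ℝ} (hx : 1 ≤ x) : planckDefect x ≤ 2 * Real.exp (-x) := by
  rw [planckDefect_eq (by linarith)]
  have h1 : 2 ≤ Real.exp x := by linarith [Real.add_one_le_exp x]
  have h2 : 0 ≤ Real.exp (-x) / x := by positivity
  have h3 : 1 / (Real.exp x - 1) ≤ 2 * Real.exp (-x) := by
    rw [Real.exp_neg, div_le_iff₀ (by linarith)]
    field_simp
    linarith
  linarith

lemma planckDefect_isBigO_exp :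
    planckDefect =O[atTop] fun x => Real.exp (-1 * x) := by
  refine Asymptotics.IsBigO.of_bound 2 ?_
  filter_upwards [eventually_ge_atTop 1] with x hx
  rw [Real.norm_of_nonneg (planckDefect_nonneg x), Real.norm_of_nonneg (Real.exp_pos _).le,
    neg_one_mul]
  exact planckDefect_le_exp hx

lemma integrableOn_planckDefect : IntegrableOn planckDefect (Ioi 0) :=
  integrable_of_isBigO_exp_neg one_pos continuous_planckDefect.continuousOn
    planckDefect_isBigO_exp

lemma locallyIntegrableOn_ofReal_planckDefect :
    LocallyIntegrableOn (fun x => (planckDefect x : ℂ)) (Ioi 0) :=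
  (Complex.continuous_ofReal.comp continuous_planckDefect).locallyIntegrable.locallyIntegrableOn _

lemma ofReal_planckDefect_isBigO_exp :
    (fun x => (planckDefect x : ℂ)) =O[atTop] fun x => Real.exp (-1 * x) := by
  refine (Asymptotics.isBigO_norm_left.1 ?_)
  simpa using planckDefect_isBigO_exp.norm_left

lemma ofReal_planckDefect_isBigO_zero :
    (fun x => (planckDefect x : ℂ)) =O[𝓝[>] 0] fun x : ℝ => x ^ (-(0 : ℝ)) := by
  simp only [neg_zero, Real.rpow_zero]
  exact (((Complex.continuous_ofReal.comp continuous_planckDefect).tendsto 0).mono_left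
    nhdsWithin_le_nhds).isBigO_one ℝ

lemma mellinConvergent_planckDefect {s : ℂ} (hs : 0 < s.re) :
    MellinConvergent (fun x => (planckDefect x : ℂ)) s :=
  mellinConvergent_of_isBigO_rpow_exp one_pos locallyIntegrableOn_ofReal_planckDefect
    ofReal_planckDefect_isBigO_exp ofReal_planckDefect_isBigO_zero hs

lemma mellin_exp_sub_one_inv {s : ℂ} (hs : 1 < s.re) :
    mellin (fun x : ℝ => ((1 / (Real.exp x - 1) : ℝ) : ℂ)) s =
      Complex.Gamma s * riemannZeta s := by
  have hsum := Complex.summable_one_div_nat_cpow.2 hs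
  have h := hasSum_mellin (a := fun _ : ℕ => (1 : ℂ)) (p := fun n : ℕ => (n : ℝ) + 1)
    (F := fun x : ℝ => ((1 / (Real.exp x - 1) : ℝ) : ℂ)) (s := s)
    (fun i => Or.inr (by positivity)) (by linarith) ?_ ?_
  · rw [zeta_eq_tsum_one_div_nat_add_one_cpow hs, ← tsum_mul_left, ← h.tsum_eq]
    refine tsum_congr fun n => ?_
    push_cast
    rw [mul_one, mul_one_div]
  · intro t ht
    have ht : 0 < t := ht
    simp only [one_mul]
    rw [Complex.hasSum_ofReal]
    have h1 : Real.exp (-t) < 1 := by simpa using ht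
    have := (hasSum_geometric_of_lt_one (Real.exp_pos (-t)).le h1).mul_left (Real.exp (-t))
    convert! this using 1
    · ext n
      rw [← Real.exp_nat_mul, ← Real.exp_add]
      ring_nf
    · have : 0 < Real.exp t - 1 := by linarith [Real.add_one_lt_exp ht.ne']
      rw [Real.exp_neg]
      field_simp
  · have := (summable_nat_add_iff 1).2 (Real.summable_one_div_nat_rpow.2 hs)
    simpa using this

lemma hasMellin_exp_neg_div {s : ℂ} (hs : 1 < s.re) :
    HasMellin (fun x : ℝ => ((Real.exp (-x) / x : ℝ) : ℂ)) s (Complex.Gamma (s - 1)) := by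
  have hs' : 0 < (s - 1).re := by simpa using hs
  have heq : ∀ x ∈ Ioi (0 : ℝ), ((Real.exp (-x) : ℝ) : ℂ) * (x : ℂ) ^ (s - 1 - 1) =
      (x : ℂ) ^ (s - 1) • ((Real.exp (-x) / x : ℝ) : ℂ) := by
    intro x hx
    have hx : (x : ℂ) ≠ 0 := by exact_mod_cast (ne_of_gt hx)
    rw [Complex.cpow_sub _ _ hx, Complex.cpow_one, smul_eq_mul]
    push_cast
    ring
  constructor
  · exact (Complex.GammaIntegral_convergent hs').congr_fun heq measurableSet_Ioi
  · rw [Complex.Gamma_eq_integral hs', Complex.GammaIntegral, mellin]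
    exact (setIntegral_congr_fun measurableSet_Ioi heq).symm

/-- The term e^{-x}/x has transform Γ(s-1) = Γ(s)/(s-1), which removes the pole of ζ. As s → 1 the
right side tends to Euler's constant. -/
lemma mellin_planckDefect {s : ℂ} (hs : 1 < s.re) :
    mellin (fun x => (planckDefect x : ℂ)) s =
      Complex.Gamma s * (riemannZeta s - 1 / (s - 1)) := by
  have hs1 : s - 1 ≠ 0 := fun h => by
    have := congrArg Complex.re h
    simp at this
    linarith
  have h := (hasMellin_add (mellinConvergent_planckDefect (s := s) (by linarith))
    (hasMellin_exp_neg_div hs).1).2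
  rw [(hasMellin_exp_neg_div hs).2] at h
  have h2 : mellin (fun x : ℝ => (planckDefect x : ℂ) + ((Real.exp (-x) / x : ℝ) : ℂ)) s =
      mellin (fun x : ℝ => ((1 / (Real.exp x - 1) : ℝ) : ℂ)) s := by
    refine setIntegral_congr_fun measurableSet_Ioi fun x hx => ?_
    simp only [planckDefect_eq hx]
    push_cast
    ring_nf
  rw [h2, mellin_exp_sub_one_inv hs] at h
  have hG : Complex.Gamma s = (s - 1) * Complex.Gamma (s - 1) := by
    have := Complex.Gamma_add_one (s - 1) hs1
    simpa using this
  rw [mul_sub, h, hG]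
  field_simp
  ring

/-- The integral representation of Euler's constant. -/
lemma integral_planckDefect : ∫ x in Ioi 0, planckDefect x = Real.eulerMascheroniConstant := by
  -- The defect is bounded at 0, so its Mellin transform is holomorphic for Re s > 0. Its value at
  -- 1, the plain integral, is thus the limit from the right.
  have hcont : ContinuousAt (mellin fun x => (planckDefect x : ℂ)) 1 :=
    (mellin_differentiableAt_of_isBigO_rpow_exp one_pos locallyIntegrableOn_ofReal_planckDefect
      ofReal_planckDefect_isBigO_exp ofReal_planckDefect_isBigO_zero (by simp)).continuousAt
  have hof : Tendsto (fun s : ℝ => (s : ℂ)) (𝓝[>] 1) (𝓝[≠] 1) := by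
    refine tendsto_nhdsWithin_iff.2 ⟨?_, ?_⟩
    · exact (Complex.continuous_ofReal.tendsto' 1 1 (by simp)).mono_left nhdsWithin_le_nhds
    · filter_upwards [self_mem_nhdsWithin] with s hs
      simpa using (ne_of_gt hs)
  have h1 := hcont.tendsto.comp (hof.mono_right nhdsWithin_le_nhds)
  have h2 : Tendsto (fun s : ℝ => Complex.Gamma s * (riemannZeta s - 1 / ((s : ℂ) - 1))) (𝓝[>] 1)
      (𝓝 (Complex.Gamma 1 * Real.eulerMascheroniConstant)) := by
    refine Tendsto.mul ?_ (tendsto_riemannZeta_sub_one_div.comp hof)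
    refine Tendsto.comp (y := 𝓝 1) ?_ (hof.mono_right nhdsWithin_le_nhds)
    exact (Complex.differentiableAt_Gamma 1 fun m h => by
      have h3 := congrArg Complex.re h
      simp at h3
      linarith [(m.cast_nonneg : (0 : ℝ) ≤ m)]).continuousAt
  have h3 := tendsto_nhds_unique (h1.congr' ?_) h2
  · rw [Complex.Gamma_one, one_mul, mellin] at h3
    simp only [sub_self, Complex.cpow_zero, one_smul] at h3
    rw [integral_complex_ofReal] at h3
    exact_mod_cast h3
  · filter_upwards [self_mem_nhdsWithin] with s hs
    exact mellin_planckDefect (by simpa using hs)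

/-! ### The divisor series and its expansion at zero -/

/-- `Σ d(n) e^{-nz}`, as a double sum. -/
def divisorSeries (z : ℂ) : ℂ :=
  ∑' p : ℕ × ℕ, Complex.exp (-((((p.1 + 1) * (p.2 + 1) : ℕ) : ℂ) * z))

/-- `Σ d(n) e^{-nu}`, as a double sum. -/
def realDivisorSeries (u : ℝ) : ℝ :=
  ∑' p : ℕ × ℕ, Real.exp (-((((p.1 + 1) * (p.2 + 1) : ℕ) : ℝ) * u))

lemma divisorSeries_ofReal (u : ℝ) : divisorSeries u = realDivisorSeries u := by
  rw [divisorSeries, realDivisorSeries, Complex.ofReal_tsum]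
  push_cast
  rfl

lemma summable_mul_succ_rpow {a : ℝ} (ha : 1 < a) :
    Summable fun p : ℕ × ℕ => ((((p.1 + 1) * (p.2 + 1) : ℕ) : ℝ) ^ a)⁻¹ := by
  have h := (summable_nat_add_iff 1).2 (Real.summable_nat_rpow_inv.2 ha)
  have h2 := h.mul_of_nonneg h (fun n => by positivity) (fun n => by positivity)
  refine h2.congr fun p => ?_
  push_cast
  rw [Real.mul_rpow (by positivity) (by positivity), mul_inv]

/-- The 3/2 only needs to exceed 1, so that Σ d(n) n^{-3/2} converges in the moment bounds.
Bracketing the half-integer power by integer ones allows y^n ≤ n! e^y to be used. -/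
lemma pow_mul_exp_neg_le (k : ℕ) {y : ℝ} (hy : 0 < y) :
    y ^ ((k : ℝ) + 3 / 2) * Real.exp (-y) ≤ (k + 1).factorial + (k + 2).factorial := by
  have h1 : y ^ ((k : ℝ) + 3 / 2) ≤ y ^ (k + 1) + y ^ (k + 2) := by
    rcases le_total y 1 with h | h
    · have : y ^ ((k : ℝ) + 3 / 2) ≤ y ^ ((k + 1 : ℕ) : ℝ) :=
        Real.rpow_le_rpow_of_exponent_ge hy h (by push_cast; linarith)
      rw [Real.rpow_natCast] at this
      linarith [pow_pos hy (k + 2)]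
    · have : y ^ ((k : ℝ) + 3 / 2) ≤ y ^ ((k + 2 : ℕ) : ℝ) :=
        Real.rpow_le_rpow_of_exponent_le h (by push_cast; linarith)
      rw [Real.rpow_natCast] at this
      linarith [pow_pos hy (k + 1)]
  have h2 : ∀ n : ℕ, y ^ n ≤ n.factorial * Real.exp y := fun n => by
    have := Real.pow_div_factorial_le_exp y hy.le n
    rwa [div_le_iff₀ (by positivity), mul_comm] at this
  rw [Real.exp_neg, ← div_eq_mul_inv, div_le_iff₀ (Real.exp_pos y)]
  linarith [h2 (k + 1), h2 (k + 2)]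

lemma moment_term_le (k : ℕ) {u : ℝ} (hu : 0 < u) (p : ℕ × ℕ) :
    (((p.1 + 1) * (p.2 + 1) : ℕ) : ℝ) ^ k * Real.exp (-((((p.1 + 1) * (p.2 + 1) : ℕ) : ℝ) * u)) ≤
      (((k + 1).factorial + (k + 2).factorial : ℝ) / u ^ ((k : ℝ) + 3 / 2)) *
      ((((p.1 + 1) * (p.2 + 1) : ℕ) : ℝ) ^ (3 / 2 : ℝ))⁻¹ := by
  have hN : (0 : ℝ) < (((p.1 + 1) * (p.2 + 1) : ℕ) : ℝ) := by positivity
  generalize (((p.1 + 1) * (p.2 + 1) : ℕ) : ℝ) = N at hN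
  have := pow_mul_exp_neg_le k (mul_pos hN hu)
  rw [Real.mul_rpow hN.le hu.le, Real.rpow_add hN, Real.rpow_natCast] at this
  rw [← div_eq_mul_inv, le_div_iff₀ (by positivity), le_div_iff₀ (by positivity)]
  linarith

lemma summable_moment (k : ℕ) {u : ℝ} (hu : 0 < u) :
    Summable fun p : ℕ × ℕ => (((p.1 + 1) * (p.2 + 1) : ℕ) : ℝ) ^ k *
      Real.exp (-((((p.1 + 1) * (p.2 + 1) : ℕ) : ℝ) * u)) :=
  Summable.of_nonneg_of_le (fun p => by positivity) (moment_term_le k hu)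
    ((summable_mul_succ_rpow (by norm_num)).mul_left _)

lemma exists_moment_le (k : ℕ) : ∃ C : ℝ, 0 ≤ C ∧ ∀ u : ℝ, 0 < u →
    ∑' p : ℕ × ℕ, (((p.1 + 1) * (p.2 + 1) : ℕ) : ℝ) ^ k *
      Real.exp (-((((p.1 + 1) * (p.2 + 1) : ℕ) : ℝ) * u)) ≤ C / u ^ ((k : ℝ) + 3 / 2) := by
  refine ⟨((k + 1).factorial + (k + 2).factorial : ℝ) *
    ∑' p : ℕ × ℕ, ((((p.1 + 1) * (p.2 + 1) : ℕ) : ℝ) ^ (3 / 2 : ℝ))⁻¹,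
    mul_nonneg (by positivity) (tsum_nonneg fun p => by positivity), fun u hu => ?_⟩
  refine ((summable_moment k hu).tsum_le_tsum (moment_term_le k hu)
    ((summable_mul_succ_rpow (by norm_num)).mul_left _)).trans (le_of_eq ?_)
  rw [tsum_mul_left]
  ring

lemma summable_realDivisorSeries {u : ℝ} (hu : 0 < u) : Summable fun p : ℕ × ℕ =>
    Real.exp (-((((p.1 + 1) * (p.2 + 1) : ℕ) : ℝ) * u)) := by
  simpa using summable_moment 0 hu

/-- Summing over one divisor first gives Σ 1/(e^{mu} - 1). The singular parts e^{-mu}/(mu) sum to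
the logarithm, and the defects remain. -/
lemma realDivisorSeries_eq {u : ℝ} (hu : 0 < u) :
    realDivisorSeries u = ∑' m : ℕ, planckDefect ((m + 1) * u) - Real.log (1 - Real.exp (-u)) / u := by
  have h1 : HasSum (fun m : ℕ => Real.exp (-((m + 1) * u)) / ((m + 1) * u))
      (-Real.log (1 - Real.exp (-u)) / u) := by
    have := (Real.hasSum_pow_div_log_of_abs_lt_one (x := Real.exp (-u)) (by
      rw [abs_of_pos (Real.exp_pos _)]; simpa using hu)).div_const u
    convert! this using 2 with m
    rw [← Real.exp_nat_mul, div_div]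
    push_cast
    ring_nf
  have h2 := summable_samples planckDefect_convexOn continuous_planckDefect.continuousOn
    (fun x _ => planckDefect_nonneg x) integrableOn_planckDefect hu
  have h3 := (h2.hasSum.add h1).tsum_eq
  rw [realDivisorSeries, (summable_realDivisorSeries hu).tsum_prod, sub_eq_add_neg, ← neg_div,
    ← h3]
  refine tsum_congr fun m => ?_
  have hm : 0 < ((m : ℝ) + 1) * u := by positivity
  rw [planckDefect_eq hm, sub_add_cancel]
  have h1 : Real.exp (-((m + 1) * u)) < 1 := by simpa using hm
  have h4 := (hasSum_geometric_of_lt_one (Real.exp_pos _).le h1).mul_left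
    (Real.exp (-((m + 1) * u)))
  have h5 : 0 < Real.exp ((m + 1) * u) - 1 := by linarith [Real.add_one_lt_exp hm.ne']
  convert! h4.tsum_eq using 1
  · refine tsum_congr fun n => ?_
    rw [← Real.exp_nat_mul, ← Real.exp_add]
    push_cast
    ring_nf
  · rw [Real.exp_neg]
    field_simp

/-- The limit is the derivative at 0 of log((1 - e^{-u})/u), whose argument extends smoothly by the
value 1. -/
lemma tendsto_log_one_sub_exp_neg_div :
    Tendsto (fun u : ℝ => (Real.log (1 - Real.exp (-u)) - Real.log u) / u) (𝓝[>] 0)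
      (𝓝 (-(1 / 2))) := by
  have hd : HasDerivAt (fun u => Real.log (expSlope (-u))) (-(1 / 2)) 0 := by
    have h1 : HasDerivAt (fun u => expSlope (-u)) (-(1 / 2)) 0 := by
      rw [hasDerivAt_iff_tendsto_slope]
      have h2 : Tendsto (fun u => -expRemainder u) (𝓝[≠] 0) (𝓝 (-(1 / 2))) := by
        rw [← expRemainder_zero]
        exact (continuous_expRemainder.neg.tendsto 0).mono_left nhdsWithin_le_nhds
      refine h2.congr' ?_
      filter_upwards [self_mem_nhdsWithin] with u hu
      have hu : u ≠ 0 := hu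
      rw [slope_def_field, expSlope_eq (neg_ne_zero.2 hu), neg_zero, expSlope_zero,
        expRemainder_eq hu]
      field_simp
      ring
    have h2 := h1.log (expSlope_pos _).ne'
    simpa [expSlope_zero] using h2
  have := (hasDerivWithinAt_iff_tendsto_slope' (by simp)).1 (hd.hasDerivWithinAt (s := Ioi 0))
  refine this.congr' ?_
  filter_upwards [self_mem_nhdsWithin] with u hu
  have hu : 0 < u := hu
  have : 0 < 1 - Real.exp (-u) := by simpa using hu
  rw [slope_def_field, expSlope_eq (by linarith), neg_zero, expSlope_zero, Real.log_one, sub_zero,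
    sub_zero, ← Real.log_div this.ne' hu.ne']
  congr 2
  rw [div_neg, ← neg_div, neg_sub]

/-- The asymptotic expansion of `Σ d(n) e^{-nu}` to the constant term. -/
lemma tendsto_realDivisorSeries_sub :
    Tendsto (fun u : ℝ => realDivisorSeries u -
      (Real.eulerMascheroniConstant - Real.log u) / u) (𝓝[>] 0) (𝓝 (1 / 4)) := by
  have h1 := tendsto_samples_sub_integral planckDefect_convexOn
    continuous_planckDefect.continuousOn (fun x _ => planckDefect_nonneg x)
    integrableOn_planckDefect
  have h2 := h1.sub tendsto_log_one_sub_exp_neg_div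
  rw [integral_planckDefect, planckDefect_zero,
    show -((1 : ℝ) / 2 / 2) - -(1 / 2) = 1 / 4 by norm_num] at h2
  refine h2.congr' ?_
  filter_upwards [self_mem_nhdsWithin] with u hu
  rw [realDivisorSeries_eq hu]
  ring

/-! ### The zeta function in the right half plane -/

/-- The right half plane without the pole of the zeta function. -/
def puncturedHalfPlane : Set ℂ := {s | 0 < s.re ∧ s ≠ 1}

lemma isOpen_puncturedHalfPlane : IsOpen puncturedHalfPlane :=
  (isOpen_lt continuous_const Complex.continuous_re).inter isOpen_ne

lemma isPreconnected_puncturedHalfPlane : IsPreconnected puncturedHalfPlane := by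
  -- The set is a union of four convex pieces: its parts above and below the real axis, Re s > 1,
  -- and 0 < Re s < 1. The pieces are joined through common points.
  have hre : ∀ c : ℝ, Convex ℝ {s : ℂ | c < s.re} := fun c => convex_halfSpace_re_gt c
  have hA : IsPreconnected ({s : ℂ | 0 < s.re} ∩ {s : ℂ | 0 < s.im}) :=
    ((hre 0).inter (convex_halfSpace_im_gt 0)).isPreconnected
  have hB : IsPreconnected ({s : ℂ | 0 < s.re} ∩ {s : ℂ | s.im < 0}) :=
    ((hre 0).inter (convex_halfSpace_im_lt 0)).isPreconnected
  have hC : IsPreconnected {s : ℂ | 1 < s.re} := (hre 1).isPreconnected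
  have hD : IsPreconnected ({s : ℂ | 0 < s.re} ∩ {s : ℂ | s.re < 1}) :=
    ((hre 0).inter (convex_halfSpace_re_lt 1)).isPreconnected
  have h1 := IsPreconnected.union (⟨2, 1⟩ : ℂ) (by simp) (by simp) hA hC
  have h2 := IsPreconnected.union (⟨2, -1⟩ : ℂ) (by simp) (by simp) h1 hB
  have h3 := IsPreconnected.union (⟨1 / 2, 1⟩ : ℂ) (by simp) (by norm_num) h2 hD
  convert! h3 using 1
  ext s
  simp only [puncturedHalfPlane, mem_ofPred_eq, mem_union, mem_inter_iff, ne_eq, Complex.ext_iff,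
    Complex.one_re, Complex.one_im]
  constructor
  · rintro ⟨h1, h2⟩
    rcases lt_trichotomy s.im 0 with h | h | h
    · exact Or.inl (Or.inr ⟨h1, h⟩)
    · rcases lt_trichotomy s.re 1 with h' | h' | h'
      · exact Or.inr ⟨h1, h'⟩
      · exact absurd ⟨h', h⟩ h2
      · exact Or.inl (Or.inl (Or.inr h'))
    · exact Or.inl (Or.inl (Or.inl ⟨h1, h⟩))
  · rintro (((⟨h1, h2⟩ | h1) | ⟨h1, h2⟩) | ⟨h1, h2⟩)
    · exact ⟨h1, fun h => h2.ne' h.2⟩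
    · exact ⟨by linarith, fun h => h1.ne' h.1⟩
    · exact ⟨h1, fun h => h2.ne h.2⟩
    · exact ⟨h1, fun h => h2.ne h.1⟩

lemma eqOn_puncturedHalfPlane {f g : ℂ → ℂ} (hf : DifferentiableOn ℂ f puncturedHalfPlane)
    (hg : DifferentiableOn ℂ g puncturedHalfPlane) (h : ∀ s : ℂ, 1 < s.re → f s = g s) :
    EqOn f g puncturedHalfPlane := by
  refine (hf.analyticOnNhd isOpen_puncturedHalfPlane).eqOn_of_preconnected_of_eventuallyEq
    (hg.analyticOnNhd isOpen_puncturedHalfPlane) isPreconnected_puncturedHalfPlane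
    (z₀ := 2) ⟨by simp, by norm_num⟩ ?_
  filter_upwards [(isOpen_lt continuous_const Complex.continuous_re).mem_nhds
    (show (1 : ℝ) < (2 : ℂ).re by simp)] with s hs using h s hs

/-- The fractional part, cut off at `1`. -/
def fractTail (t : ℝ) : ℂ := (Ioi (1 : ℝ)).indicator (fun t => ((Int.fract t : ℝ) : ℂ)) t

lemma norm_fractTail_le (t : ℝ) : ‖fractTail t‖ ≤ 1 := by
  rw [fractTail, indicator_apply]
  split_ifs
  · rw [Complex.norm_real, Real.norm_of_nonneg (Int.fract_nonneg t)]
    exact (Int.fract_lt_one t).le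
  · simp

lemma measurable_fractTail : Measurable fractTail :=
  (Complex.measurable_ofReal.comp measurable_fract).indicator measurableSet_Ioi

lemma locallyIntegrableOn_fractTail : LocallyIntegrableOn fractTail (Ioi 0) := by
  have : LocallyIntegrable fractTail :=
    (locallyIntegrable_const (1 : ℝ)).mono measurable_fractTail.aestronglyMeasurable
      (ae_of_all _ fun t => by simpa using norm_fractTail_le t)
  exact this.locallyIntegrableOn _

lemma fractTail_isBigO_top : fractTail =O[atTop] fun t : ℝ => t ^ (-(0 : ℝ)) := by
  simp only [neg_zero, Real.rpow_zero]
  exact Asymptotics.IsBigO.of_bound 1 (Eventually.of_forall fun t => by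
    simpa using norm_fractTail_le t)

lemma fractTail_isBigO_zero (b : ℝ) : fractTail =O[𝓝[>] 0] fun t : ℝ => t ^ (-b) := by
  refine Asymptotics.IsBigO.of_bound 1 ?_
  filter_upwards [Ioo_mem_nhdsGT one_pos] with t ht
  have : t ∉ Ioi (1 : ℝ) := fun h => absurd h (not_lt.2 ht.2.le)
  rw [fractTail, indicator_of_notMem this]
  simp

lemma differentiableAt_mellin_fractTail {s : ℂ} (hs : s.re < 0) :
    DifferentiableAt ℂ (mellin fractTail) s :=
  mellin_differentiableAt_of_isBigO_rpow locallyIntegrableOn_fractTail fractTail_isBigO_top hs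
    (fractTail_isBigO_zero (s.re - 1)) (by linarith)

lemma mellinConvergent_fractTail {s : ℂ} (hs : s.re < 0) : MellinConvergent fractTail s :=
  mellinConvergent_of_isBigO_rpow locallyIntegrableOn_fractTail fractTail_isBigO_top hs
    (fractTail_isBigO_zero (s.re - 1)) (by linarith)

lemma mellin_fractTail (s : ℂ) :
    mellin fractTail (-s) = ∫ t in Ioi (1 : ℝ), (t : ℂ) ^ (-(s + 1)) * ((Int.fract t : ℝ) : ℂ) := by
  have : ∀ t : ℝ, (t : ℂ) ^ (-s - 1) • fractTail t =
      (Ioi (1 : ℝ)).indicator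
        (fun t => (t : ℂ) ^ (-(s + 1)) * ((Int.fract t : ℝ) : ℂ)) t := fun t => by
    rw [fractTail, smul_eq_mul, indicator_mul_right, neg_add']
  rw [mellin]
  simp_rw [this]
  rw [setIntegral_indicator measurableSet_Ioi,
    inter_eq_right.2 (Ioi_subset_Ioi zero_le_one)]

/-- Abel summation expresses ζ(s) through the counting function ⌊t⌋ = t - {t}. The Mellin integral
of {t} converges for Re s > 0, so the formula then extends to the punctured half plane. -/
lemma riemannZeta_eq_of_one_lt {s : ℂ} (hs : 1 < s.re) :
    riemannZeta s = s / (s - 1) - s * mellin fractTail (-s) := by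
  have h1 := LSeries_eq_mul_integral' (fun _ => (1 : ℂ)) (r := 1) zero_le_one hs (by
    refine Asymptotics.IsBigO.of_bound 1 (Eventually.of_forall fun n => ?_)
    simp)
  have h2 := LSeries_one_eq_riemannZeta hs
  rw [show LSeries 1 s = LSeries (fun _ => (1 : ℂ)) s from rfl] at h2
  rw [← h2, h1, mellin_fractTail]
  have hi1 : IntegrableOn (fun t : ℝ => (t : ℂ) ^ (-s)) (Ioi 1) :=
    integrableOn_Ioi_cpow_of_lt (by simpa using hs) one_pos
  have hi2 : IntegrableOn (fun t : ℝ => (t : ℂ) ^ (-(s + 1)) * ((Int.fract t : ℝ) : ℂ)) (Ioi 1) := by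
    have h0 := mellinConvergent_fractTail (s := -s) (by simp; linarith)
    refine (h0.mono_set (Ioi_subset_Ioi zero_le_one)).congr_fun (fun t ht => ?_) measurableSet_Ioi
    simp only [fractTail, smul_eq_mul]
    rw [indicator_of_mem ht, neg_add']
  have h3 : ∫ t in Ioi (1 : ℝ), (t : ℂ) ^ (-s) = 1 / (s - 1) := by
    rw [integral_Ioi_cpow_of_lt (by simpa using hs) one_pos]
    simp only [Complex.ofReal_one, Complex.one_cpow]
    rw [show -s + 1 = -(s - 1) by ring, neg_div_neg_eq]
  have h4 : ∫ t in Ioi (1 : ℝ), (∑ k ∈ Finset.Icc 1 ⌊t⌋₊, (1 : ℂ)) * (t : ℂ) ^ (-(s + 1)) =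
      ∫ t in Ioi (1 : ℝ), ((t : ℂ) ^ (-s) - (t : ℂ) ^ (-(s + 1)) * ((Int.fract t : ℝ) : ℂ)) := by
    refine setIntegral_congr_fun measurableSet_Ioi fun t ht => ?_
    have ht : 1 < t := ht
    have h5 : ((⌊t⌋₊ : ℝ) : ℂ) = ((t - Int.fract t : ℝ) : ℂ) := by
      rw [Int.self_sub_fract, natCast_floor_eq_intCast_floor (by linarith)]
    have h6 : (t : ℂ) ^ (-s) = (t : ℂ) ^ (-(s + 1)) * t := by
      have h0 : (t : ℂ) ≠ 0 := by exact_mod_cast (by linarith : t ≠ 0)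
      nth_rewrite 3 [← Complex.cpow_one (t : ℂ)]
      rw [← Complex.cpow_add _ _ h0]
      ring_nf
    simp only [Finset.sum_const, Nat.card_Icc, add_tsub_cancel_right, nsmul_eq_mul, mul_one]
    rw [h6]
    push_cast at h5
    rw [h5]
    ring
  rw [h4, integral_sub hi1 hi2, h3]
  ring

lemma riemannZeta_eq {s : ℂ} (hs : s ∈ puncturedHalfPlane) :
    riemannZeta s = s / (s - 1) - s * mellin fractTail (-s) := by
  refine eqOn_puncturedHalfPlane (f := riemannZeta) ?_ ?_ (fun s hs => riemannZeta_eq_of_one_lt hs)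
    hs
  · exact fun s hs => (differentiableAt_riemannZeta hs.2).differentiableWithinAt
  · intro s hs
    have h1 : DifferentiableAt ℂ (fun s => mellin fractTail (-s)) s :=
      (differentiableAt_mellin_fractTail (s := -s) (by simpa using hs.1)).comp s
        differentiableAt_id.neg
    have h2 : DifferentiableAt ℂ (fun s : ℂ => s / (s - 1)) s :=
      differentiableAt_id.div (differentiableAt_id.sub_const 1) (sub_ne_zero.2 hs.2)
    exact (h2.sub (differentiableAt_id.mul h1)).differentiableWithinAt

lemma half_mem_puncturedHalfPlane (t : ℝ) : (1 / 2 + (t : ℂ) * Complex.I) ∈ puncturedHalfPlane := by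
  refine ⟨by simp, fun h => ?_⟩
  have := congrArg Complex.re h
  norm_num at this

lemma norm_mellin_fractTail_le (t : ℝ) :
    ‖mellin fractTail (-(1 / 2 + (t : ℂ) * Complex.I))‖ ≤ 2 := by
  rw [mellin_fractTail]
  have h : ∫ t in Ioi (1 : ℝ), t ^ (-(3 / 2) : ℝ) = 2 := by
    rw [integral_Ioi_rpow_of_lt (by norm_num) one_pos]
    norm_num
  rw [← h]
  refine norm_integral_le_of_norm_le (integrableOn_Ioi_rpow_of_lt (by norm_num) one_pos) ?_
  refine (ae_restrict_iff' measurableSet_Ioi).2 (ae_of_all _ fun x hx => ?_)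
  have hx : 1 < x := hx
  rw [norm_mul, Complex.norm_cpow_eq_rpow_re_of_pos (by linarith), Complex.norm_real,
    Real.norm_of_nonneg (Int.fract_nonneg x)]
  have : (-(1 / 2 + (t : ℂ) * Complex.I + 1)).re = -(3 / 2) := by
    simp
    norm_num
  rw [this]
  exact mul_le_of_le_one_right (by positivity) (Int.fract_lt_one x).le

/-- A crude bound for the zeta function on the critical line. -/
lemma norm_riemannZeta_half_le (t : ℝ) :
    ‖riemannZeta (1 / 2 + (t : ℂ) * Complex.I)‖ ≤ 2 + 2 * |t| := by
  set s : ℂ := 1 / 2 + (t : ℂ) * Complex.I with hs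
  have h0 := half_mem_puncturedHalfPlane t
  rw [riemannZeta_eq h0]
  have h1 : ‖s‖ = ‖s - 1‖ := by
    rw [← sq_eq_sq₀ (norm_nonneg _) (norm_nonneg _), ← Complex.normSq_eq_norm_sq,
      ← Complex.normSq_eq_norm_sq, Complex.normSq_apply, Complex.normSq_apply]
    simp [hs]
    norm_num
  have h2 : ‖s / (s - 1)‖ = 1 := by
    rw [norm_div, h1, div_self (norm_ne_zero_iff.2 (sub_ne_zero.2 h0.2))]
  have h3 : ‖s‖ ≤ 1 / 2 + |t| := by
    refine (norm_add_le _ _).trans (le_of_eq ?_)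
    simp
  have h4 := norm_mellin_fractTail_le t
  calc _ ≤ ‖s / (s - 1)‖ + ‖s * mellin fractTail (-s)‖ := norm_sub_le _ _
    _ ≤ 1 + (1 / 2 + |t|) * 2 := by
      rw [h2, norm_mul]
      gcongr
    _ = _ := by ring

/-- At s = 1/2 the term s/(s-1) is -1 and the fractional part integral is nonnegative, so ζ(1/2) ≤
-1. This is later what makes the left side of the ladder equation strictly monotone. -/
lemma zetaSq_zero_pos : 0 < zetaSq 0 := by
  have h0 := half_mem_puncturedHalfPlane 0
  have h1 : (riemannZeta (1 / 2 + ((0 : ℝ) : ℂ) * Complex.I)).re ≤ -1 := by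
    rw [riemannZeta_eq h0, mellin_fractTail]
    have h2 : ∫ t in Ioi (1 : ℝ), (t : ℂ) ^ (-(1 / 2 + ((0 : ℝ) : ℂ) * Complex.I + 1)) *
        ((Int.fract t : ℝ) : ℂ) =
        ((∫ t in Ioi (1 : ℝ), t ^ (-(3 / 2) : ℝ) * Int.fract t : ℝ) : ℂ) := by
      rw [← integral_complex_ofReal]
      refine setIntegral_congr_fun measurableSet_Ioi fun t ht => ?_
      have ht : 1 < t := ht
      push_cast
      rw [Complex.ofReal_cpow (by linarith)]
      push_cast
      norm_num
    rw [h2]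
    have h3 : 0 ≤ ∫ t in Ioi (1 : ℝ), t ^ (-(3 / 2) : ℝ) * Int.fract t :=
      setIntegral_nonneg measurableSet_Ioi fun t ht =>
        mul_nonneg (Real.rpow_nonneg (le_trans zero_le_one (le_of_lt ht)) _) (Int.fract_nonneg t)
    generalize (∫ t in Ioi (1 : ℝ), t ^ (-(3 / 2) : ℝ) * Int.fract t) = r at h3
    have : (1 / 2 + ((0 : ℝ) : ℂ) * Complex.I) / (1 / 2 + ((0 : ℝ) : ℂ) * Complex.I - 1) -
      (1 / 2 + ((0 : ℝ) : ℂ) * Complex.I) * (r : ℂ) = ((-1 - r / 2 : ℝ) : ℂ) := by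
      push_cast
      norm_num
      ring
    rw [this, Complex.ofReal_re]
    linarith
  refine pow_pos (norm_pos_iff.2 fun h => ?_) 2
  rw [h] at h1
  norm_num at h1

lemma continuous_zeta_half : Continuous fun t : ℝ => riemannZeta (1 / 2 + (t : ℂ) * Complex.I) := by
  refine continuous_iff_continuousAt.2 fun t => ?_
  have h := (differentiableAt_riemannZeta (half_mem_puncturedHalfPlane t).2).continuousAt
  exact ContinuousAt.comp (f := fun t : ℝ => 1 / 2 + (t : ℂ) * Complex.I) h (by fun_prop)

lemma continuous_zetaSq : Continuous zetaSq := continuous_zeta_half.norm.pow 2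

lemma zetaSq_nonneg (t : ℝ) : 0 ≤ zetaSq t := sq_nonneg _

lemma zetaSq_le (t : ℝ) : zetaSq t ≤ (2 + 2 * |t|) ^ 2 :=
  pow_le_pow_left₀ (norm_nonneg _) (norm_riemannZeta_half_le t) 2

lemma zetaSq_neg (t : ℝ) : zetaSq (-t) = zetaSq t := by
  have : (1 / 2 + ((-t : ℝ) : ℂ) * Complex.I) =
      (starRingEnd ℂ) (1 / 2 + (t : ℂ) * Complex.I) := by
    simp [Complex.ext_iff]
  rw [zetaSq, zetaSq, this, riemannZeta_conj, RCLike.norm_conj]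

/-! ### The Mellin transform of the divisor series -/

lemma differentiableOn_divisorSeries : DifferentiableOn ℂ divisorSeries {z | 0 < z.re} := by
  intro z hz
  have hz : 0 < z.re := hz
  have h1 : DifferentiableOn ℂ divisorSeries {w | z.re / 2 < w.re} := by
    refine Complex.differentiableOn_tsum_of_summable_norm
      (summable_realDivisorSeries (half_pos hz)) (fun p => by fun_prop)
      (isOpen_lt continuous_const Complex.continuous_re) fun p w hw => ?_
    have hw : z.re / 2 < w.re := hw
    rw [Complex.norm_exp, Complex.neg_re, ← Complex.ofReal_natCast, Complex.re_ofReal_mul]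
    gcongr
  have hmem : {w : ℂ | z.re / 2 < w.re} ∈ 𝓝 z :=
    (isOpen_lt continuous_const Complex.continuous_re).mem_nhds (show z.re / 2 < z.re by linarith)
  exact (h1.differentiableAt hmem).differentiableWithinAt

lemma continuousOn_realDivisorSeries_ofReal :
    ContinuousOn (fun x : ℝ => (realDivisorSeries x : ℂ)) (Ioi 0) := by
  simp_rw [← divisorSeries_ofReal]
  exact differentiableOn_divisorSeries.continuousOn.comp Complex.continuous_ofReal.continuousOn
    fun x hx => by simpa using hx

lemma realDivisorSeries_nonneg (u : ℝ) : 0 ≤ realDivisorSeries u :=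
  tsum_nonneg fun _ => (Real.exp_pos _).le

/-- Every index N is at least 1, so N(u - 1) ≥ u - 1 and a factor e^{1-u} splits off each term. -/
lemma realDivisorSeries_le_exp {u : ℝ} (hu : 1 ≤ u) :
    realDivisorSeries u ≤ Real.exp 1 * realDivisorSeries 1 * Real.exp (-u) := by
  have : ∀ p : ℕ × ℕ, Real.exp (-((((p.1 + 1) * (p.2 + 1) : ℕ) : ℝ) * u)) ≤
      Real.exp (1 - u) * Real.exp (-((((p.1 + 1) * (p.2 + 1) : ℕ) : ℝ) * 1)) := fun p => by
    rw [← Real.exp_add]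
    refine Real.exp_le_exp.2 ?_
    have h1 : (1 : ℝ) ≤ (((p.1 + 1) * (p.2 + 1) : ℕ) : ℝ) := by
      exact_mod_cast Nat.succ_le_of_lt (by positivity)
    nlinarith
  refine ((summable_realDivisorSeries (by linarith)).tsum_le_tsum this
    ((summable_realDivisorSeries one_pos).mul_left _)).trans (le_of_eq ?_)
  rw [tsum_mul_left, sub_eq_add_neg, Real.exp_add]
  simp only [realDivisorSeries]
  ring

lemma mellin_realDivisorSeries {s : ℂ} (hs : 1 < s.re) :
    mellin (fun x => (realDivisorSeries x : ℂ)) s = Complex.Gamma s * riemannZeta s ^ 2 := by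
  have h := hasSum_mellin (a := fun _ : ℕ × ℕ => (1 : ℂ))
    (p := fun p : ℕ × ℕ => (((p.1 + 1) * (p.2 + 1) : ℕ) : ℝ))
    (F := fun x => (realDivisorSeries x : ℂ)) (s := s)
    (fun i => Or.inr (by positivity)) (by linarith) ?_ ?_
  · have hz : Summable fun n : ℕ => ‖1 / ((n : ℂ) + 1) ^ s‖ := by
      have := (summable_nat_add_iff 1).2 (Complex.summable_one_div_nat_cpow.2 hs).norm
      simpa using this
    rw [zeta_eq_tsum_one_div_nat_add_one_cpow hs, sq, tsum_mul_tsum_of_summable_norm hz hz,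
      ← tsum_mul_left, ← h.tsum_eq]
    refine tsum_congr fun p => ?_
    have : ((((p.1 + 1) * (p.2 + 1) : ℕ) : ℝ) : ℂ) ^ s =
        ((p.1 : ℂ) + 1) ^ s * ((p.2 : ℂ) + 1) ^ s := by
      have := Complex.mul_cpow_ofReal_nonneg (a := (p.1 : ℝ) + 1) (b := (p.2 : ℝ) + 1)
        (by positivity) (by positivity) s
      push_cast at this ⊢
      exact this
    rw [this]
    field_simp
  · intro t ht
    simp only [one_mul]
    rw [Complex.hasSum_ofReal]
    simpa [realDivisorSeries] using (summable_realDivisorSeries (mem_Ioi.1 ht)).hasSum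
  · simpa using summable_mul_succ_rpow hs

lemma locallyIntegrableOn_indicator {f : ℝ → ℂ} {s t : Set ℝ} (hf : LocallyIntegrableOn f s)
    (ht : MeasurableSet t) : LocallyIntegrableOn (t.indicator f) s := fun x hx => by
  obtain ⟨U, hU, h⟩ := hf x hx
  exact ⟨U, hU, h.indicator ht⟩

lemma locallyIntegrableOn_cpow_neg_one :
    LocallyIntegrableOn (fun t : ℝ => (t : ℂ) ^ (-1 : ℂ)) (Ioi 0) := by
  refine ContinuousOn.locallyIntegrableOn ?_ measurableSet_Ioi
  intro t ht
  exact (Complex.continuousAt_ofReal_cpow_const t (-1)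
    (Or.inr (ne_of_gt ht))).continuousWithinAt

lemma sub_one_ne_zero_of_re_lt {s : ℂ} (hs : s.re ≠ 1) : s - 1 ≠ 0 := fun h => by
  have := congrArg Complex.re h
  simp at this
  exact hs (by linarith)

lemma hasDerivAt_one_div_sub_one {s : ℂ} (hs : s.re ≠ 1) :
    HasDerivAt (fun s : ℂ => 1 / (s - 1)) (-1 / (s - 1) ^ 2) s := by
  simpa [Function.comp_def] using! ((hasDerivAt_id s).sub_const 1).inv (sub_one_ne_zero_of_re_lt hs)

/-- The powers `t⁻¹`, cut off to `(0, 1]`. -/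
def invHead : ℝ → ℂ := indicator (Ioc 0 1) fun t => (t : ℂ) ^ (-1 : ℂ)

/-- The powers `t⁻¹`, cut off to `(1, ∞)`. -/
def invTail : ℝ → ℂ := indicator (Ioi 1) fun t => (t : ℂ) ^ (-1 : ℂ)

lemma invHead_isBigO_top (a : ℝ) : invHead =O[atTop] fun t : ℝ => t ^ (-a) := by
  refine Asymptotics.IsBigO.of_bound 1 ?_
  filter_upwards [eventually_gt_atTop 1] with t ht
  rw [invHead, indicator_of_notMem (fun h => absurd h.2 (not_le.2 ht))]
  simp

lemma invTail_isBigO_zero (a : ℝ) : invTail =O[𝓝[>] 0] fun t : ℝ => t ^ (-a) := by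
  refine Asymptotics.IsBigO.of_bound 1 ?_
  filter_upwards [Ioo_mem_nhdsGT one_pos] with t ht
  rw [invTail, indicator_of_notMem (show t ∉ Ioi (1 : ℝ) from not_lt.2 ht.2.le)]
  simp

lemma norm_indicator_cpow_neg_one_le {S : Set ℝ} {t : ℝ} (ht : 0 < t) :
    ‖indicator S (fun t : ℝ => (t : ℂ) ^ (-1 : ℂ)) t‖ ≤ 1 * ‖t ^ (-1 : ℝ)‖ := by
  rw [one_mul]
  refine (norm_indicator_le_norm_self _ _).trans (le_of_eq ?_)
  rw [Complex.norm_cpow_eq_rpow_re_of_pos ht, Real.norm_of_nonneg (by positivity)]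
  simp

lemma invHead_isBigO_zero : invHead =O[𝓝[>] 0] fun t : ℝ => t ^ (-1 : ℝ) := by
  refine Asymptotics.IsBigO.of_bound 1 ?_
  filter_upwards [self_mem_nhdsWithin] with t ht using norm_indicator_cpow_neg_one_le ht

lemma invTail_isBigO_top : invTail =O[atTop] fun t : ℝ => t ^ (-1 : ℝ) := by
  refine Asymptotics.IsBigO.of_bound 1 ?_
  filter_upwards [eventually_gt_atTop 0] with t ht using norm_indicator_cpow_neg_one_le ht

lemma hasMellin_invHead {s : ℂ} (hs : 1 < s.re) : HasMellin invHead s (1 / (s - 1)) := by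
  simpa [sub_eq_add_neg, invHead] using hasMellin_cpow_Ioc (-1) (s := s) (by simpa using hs)

lemma hasMellin_log_invHead {s : ℂ} (hs : 1 < s.re) :
    HasMellin (fun t => Real.log t • invHead t) s (-1 / (s - 1) ^ 2) := by
  have h := mellin_hasDerivAt_of_isBigO_rpow
    (locallyIntegrableOn_indicator locallyIntegrableOn_cpow_neg_one measurableSet_Ioc)
    (invHead_isBigO_top (s.re + 1)) (lt_add_one _) invHead_isBigO_zero hs
  refine ⟨h.1, h.2.unique ?_⟩
  refine (hasDerivAt_one_div_sub_one hs.ne').congr_of_eventuallyEq ?_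
  filter_upwards [(isOpen_lt continuous_const Complex.continuous_re).mem_nhds hs] with z hz
  exact (hasMellin_invHead hz).2

lemma hasMellin_invTail {s : ℂ} (hs : s.re < 1) : HasMellin invTail s (-(1 / (s - 1))) := by
  refine ⟨mellinConvergent_of_isBigO_rpow
    (locallyIntegrableOn_indicator locallyIntegrableOn_cpow_neg_one measurableSet_Ioi)
    invTail_isBigO_top hs (invTail_isBigO_zero (s.re - 1)) (by linarith), ?_⟩
  have : ∀ t ∈ Ioi (0 : ℝ), (t : ℂ) ^ (s - 1) • invTail t =
      (Ioi (1 : ℝ)).indicator (fun t => (t : ℂ) ^ (s - 2)) t := fun t ht => by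
    have h0 : (t : ℂ) ≠ 0 := by exact_mod_cast (ne_of_gt ht)
    rw [invTail, smul_eq_mul, indicator_apply, indicator_apply]
    split_ifs
    · rw [← Complex.cpow_add _ _ h0]
      ring_nf
    · simp
  rw [mellin, setIntegral_congr_fun measurableSet_Ioi this, setIntegral_indicator measurableSet_Ioi,
    inter_eq_right.2 (Ioi_subset_Ioi zero_le_one), integral_Ioi_cpow_of_lt (by simp; linarith)
    one_pos, Complex.ofReal_one, Complex.one_cpow, neg_div, show s - 2 + 1 = s - 1 by ring]

lemma hasMellin_log_invTail {s : ℂ} (hs : s.re < 1) :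
    HasMellin (fun t => Real.log t • invTail t) s (1 / (s - 1) ^ 2) := by
  have h := mellin_hasDerivAt_of_isBigO_rpow
    (locallyIntegrableOn_indicator locallyIntegrableOn_cpow_neg_one measurableSet_Ioi)
    invTail_isBigO_top hs (invTail_isBigO_zero (s.re - 1)) (by linarith)
  refine ⟨h.1, h.2.unique ?_⟩
  have h2 := (hasDerivAt_one_div_sub_one hs.ne).neg
  rw [← neg_div, neg_neg] at h2
  refine h2.congr_of_eventuallyEq ?_
  filter_upwards [(isOpen_lt Complex.continuous_re continuous_const).mem_nhds hs] with z hz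
  exact (hasMellin_invTail hz).2

/-- The main term `(γ - log x) / x`, cut off to `(0, 1]`. -/
def mainHead (x : ℝ) : ℂ := (Real.eulerMascheroniConstant : ℂ) • invHead x - Real.log x • invHead x

/-- The main term `(γ - log x) / x`, cut off to `(1, ∞)`. -/
def mainTail (x : ℝ) : ℂ := (Real.eulerMascheroniConstant : ℂ) • invTail x - Real.log x • invTail x

lemma mainHead_of_le {x : ℝ} (h0 : 0 < x) (h1 : x ≤ 1) :
    mainHead x = (((Real.eulerMascheroniConstant - Real.log x) / x : ℝ) : ℂ) := by
  rw [mainHead, invHead, indicator_of_mem (show x ∈ Ioc (0 : ℝ) 1 from ⟨h0, h1⟩),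
    Complex.cpow_neg_one, smul_eq_mul, Complex.real_smul]
  push_cast
  ring

lemma mainHead_of_gt {x : ℝ} (h1 : 1 < x) : mainHead x = 0 := by
  rw [mainHead, invHead, indicator_of_notMem (fun h => absurd h.2 (not_le.2 h1))]
  simp

lemma mainHead_add_mainTail {x : ℝ} (h0 : 0 < x) :
    mainHead x + mainTail x = (((Real.eulerMascheroniConstant - Real.log x) / x : ℝ) : ℂ) := by
  have : invHead x + invTail x = (x : ℂ)⁻¹ := by
    rcases le_or_gt x 1 with h | h
    · rw [invHead, invTail, indicator_of_mem (show x ∈ Ioc (0 : ℝ) 1 from ⟨h0, h⟩),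
        indicator_of_notMem (show x ∉ Ioi (1 : ℝ) from not_lt.2 h), Complex.cpow_neg_one, add_zero]
    · rw [invHead, invTail, indicator_of_mem (show x ∈ Ioi (1 : ℝ) from h),
        indicator_of_notMem (fun h' => absurd h'.2 (not_le.2 h)), Complex.cpow_neg_one, zero_add]
  calc _ = ((Real.eulerMascheroniConstant : ℂ) - Real.log x) * (invHead x + invTail x) := by
        rw [mainHead, mainTail, smul_eq_mul, smul_eq_mul, Complex.real_smul, Complex.real_smul]
        ring
    _ = _ := by
      rw [this]
      push_cast
      ring

lemma hasMellin_mainHead {s : ℂ} (hs : 1 < s.re) :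
    HasMellin mainHead s (Real.eulerMascheroniConstant / (s - 1) + 1 / (s - 1) ^ 2) := by
  have h1 := hasMellin_const_smul (hasMellin_invHead hs).1 (Real.eulerMascheroniConstant : ℂ)
  have h2 := hasMellin_sub h1.1 (hasMellin_log_invHead hs).1
  refine ⟨h2.1, h2.2.trans ?_⟩
  rw [h1.2, (hasMellin_invHead hs).2, (hasMellin_log_invHead hs).2, smul_eq_mul]
  ring

lemma hasMellin_mainTail {s : ℂ} (hs : s.re < 1) :
    HasMellin mainTail s (-(Real.eulerMascheroniConstant / (s - 1) + 1 / (s - 1) ^ 2)) := by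
  have h1 := hasMellin_const_smul (hasMellin_invTail hs).1 (Real.eulerMascheroniConstant : ℂ)
  have h2 := hasMellin_sub h1.1 (hasMellin_log_invTail hs).1
  refine ⟨h2.1, h2.2.trans ?_⟩
  rw [h1.2, (hasMellin_invTail hs).2, (hasMellin_log_invTail hs).2, smul_eq_mul]
  ring

/-- The divisor series with its singular part at `0` removed. -/
def regularized (x : ℝ) : ℂ := realDivisorSeries x - mainHead x

lemma locallyIntegrableOn_mainHead : LocallyIntegrableOn mainHead (Ioi 0) := by
  have h1 : LocallyIntegrableOn invHead (Ioi 0) :=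
    locallyIntegrableOn_indicator locallyIntegrableOn_cpow_neg_one measurableSet_Ioc
  refine LocallyIntegrableOn.sub
    (f := fun x => (Real.eulerMascheroniConstant : ℂ) • invHead x)
    (h1.continuousOn_smul isOpen_Ioi.isLocallyClosed continuousOn_const) ?_
  exact h1.continuousOn_smul isOpen_Ioi.isLocallyClosed
    (Real.continuousOn_log.mono fun x hx => ne_of_gt hx)

lemma locallyIntegrableOn_regularized : LocallyIntegrableOn regularized (Ioi 0) :=
  (continuousOn_realDivisorSeries_ofReal.locallyIntegrableOn measurableSet_Ioi).sub
    locallyIntegrableOn_mainHead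

lemma regularized_isBigO_top : regularized =O[atTop] fun x => Real.exp (-1 * x) := by
  refine Asymptotics.IsBigO.of_bound (Real.exp 1 * realDivisorSeries 1) ?_
  filter_upwards [eventually_gt_atTop 1] with x hx
  rw [regularized, mainHead_of_gt hx, sub_zero, Complex.norm_real,
    Real.norm_of_nonneg (realDivisorSeries_nonneg x), Real.norm_of_nonneg (Real.exp_pos _).le,
    neg_one_mul]
  exact realDivisorSeries_le_exp hx.le

lemma regularized_isBigO_zero : regularized =O[𝓝[>] 0] fun x : ℝ => x ^ (-(0 : ℝ)) := by
  simp only [neg_zero, Real.rpow_zero]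
  refine Tendsto.isBigO_one ℝ (c := ((1 / 4 : ℝ) : ℂ)) ?_
  refine ((Complex.continuous_ofReal.tendsto _).comp tendsto_realDivisorSeries_sub).congr' ?_
  filter_upwards [Ioo_mem_nhdsGT one_pos] with x hx
  rw [regularized, mainHead_of_le hx.1 hx.2.le]
  simp

lemma mellinConvergent_regularized {s : ℂ} (hs : 0 < s.re) : MellinConvergent regularized s :=
  mellinConvergent_of_isBigO_rpow_exp one_pos locallyIntegrableOn_regularized
    regularized_isBigO_top regularized_isBigO_zero hs

lemma mellin_regularized_of_one_lt {s : ℂ} (hs : 1 < s.re) :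
    mellin regularized s = Complex.Gamma s * riemannZeta s ^ 2 -
      (Real.eulerMascheroniConstant / (s - 1) + 1 / (s - 1) ^ 2) := by
  have h := (hasMellin_add (mellinConvergent_regularized (s := s) (by linarith))
    (hasMellin_mainHead hs).1).2
  simp only [regularized, sub_add_cancel] at h
  rw [mellin_realDivisorSeries hs, (hasMellin_mainHead hs).2] at h
  rw [h]
  simp

lemma differentiableAt_Gamma_of_re_pos {s : ℂ} (hs : 0 < s.re) :
    DifferentiableAt ℂ Complex.Gamma s :=
  Complex.differentiableAt_Gamma s fun m h => by
    have := congrArg Complex.re h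
    simp at this
    linarith [(m.cast_nonneg : (0 : ℝ) ≤ m)]

lemma mellin_regularized {s : ℂ} (hs : s ∈ puncturedHalfPlane) :
    mellin regularized s = Complex.Gamma s * riemannZeta s ^ 2 -
      (Real.eulerMascheroniConstant / (s - 1) + 1 / (s - 1) ^ 2) := by
  refine eqOn_puncturedHalfPlane (f := mellin regularized) ?_ ?_
    (fun s hs => mellin_regularized_of_one_lt hs) hs
  · exact fun s hs => (mellin_differentiableAt_of_isBigO_rpow_exp one_pos
      locallyIntegrableOn_regularized regularized_isBigO_top regularized_isBigO_zero
      hs.1).differentiableWithinAt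
  · intro s hs
    have h1 : DifferentiableAt ℂ (fun s : ℂ => s - 1) s := by fun_prop
    have h0 : s - 1 ≠ 0 := sub_ne_zero.2 hs.2
    have h2 := (differentiableAt_Gamma_of_re_pos hs.1).mul ((differentiableAt_riemannZeta hs.2).pow 2)
    have h3 := ((differentiableAt_const (Real.eulerMascheroniConstant : ℂ)).div h1 h0).add
      ((differentiableAt_const (1 : ℂ)).div (h1.pow 2) (pow_ne_zero 2 h0))
    exact (h2.sub h3).differentiableWithinAt

/-- The divisor series minus the main term of its expansion at `0`. -/
def divisorRemainder (x : ℝ) : ℂ :=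
  realDivisorSeries x - (((Real.eulerMascheroniConstant - Real.log x) / x : ℝ) : ℂ)

/-- The part of the main term on (0, 1] has its transform in Re s > 1, the part on (1, ∞) in Re s <
1, and the two are given by opposite rational functions. Subtracting the second part therefore
cancels the polar terms left by continuing the transform of `regularized`, and only Γζ² remains in
the strip. -/
lemma hasMellin_divisorRemainder {s : ℂ} (h0 : 0 < s.re) (h1 : s.re < 1) :
    HasMellin divisorRemainder s (Complex.Gamma s * riemannZeta s ^ 2) := by
  have h := hasMellin_sub (mellinConvergent_regularized h0) (hasMellin_mainTail h1).1
  have heq : ∀ x ∈ Ioi (0 : ℝ), regularized x - mainTail x = divisorRemainder x := fun x hx => by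
    rw [divisorRemainder, ← mainHead_add_mainTail hx, regularized, sub_sub]
  constructor
  · exact h.1.congr_fun (fun x hx => by simp only [heq x hx]) measurableSet_Ioi
  · have h2 : mellin divisorRemainder s = mellin (fun x => regularized x - mainTail x) s :=
      setIntegral_congr_fun measurableSet_Ioi fun x hx => by simp only [heq x hx]
    rw [h2, h.2, (hasMellin_mainTail h1).2,
      mellin_regularized ⟨h0, fun h => by rw [h] at h1; simp at h1⟩]
    ring

/-! ### Mellin inversion and rotation of the argument -/

lemma integrable_exp_neg_mul_abs {a : ℝ} (ha : 0 < a) :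
    Integrable fun t : ℝ => Real.exp (-(a * |t|)) := by
  have h1 : IntegrableOn (fun t : ℝ => Real.exp (-(a * |t|))) (Ioi 0) := by
    refine (integrableOn_exp_mul_Ioi (neg_neg_of_pos ha) 0).congr_fun (fun t ht => ?_)
      measurableSet_Ioi
    simp only [abs_of_pos (mem_Ioi.1 ht)]
    ring_nf
  have h2 : IntegrableOn (fun t : ℝ => Real.exp (-(a * |t|))) (Iic 0) := by
    refine (integrableOn_exp_mul_Iic ha 0).congr_fun (fun t ht => ?_) measurableSet_Iic
    simp only [abs_of_nonpos (mem_Iic.1 ht)]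
    ring_nf
  rw [← integrableOn_univ, ← Iic_union_Ioi (a := (0 : ℝ))]
  exact h2.union h1

lemma pow_mul_exp_neg_abs_le (n : ℕ) {a : ℝ} (ha : 0 < a) (t : ℝ) :
    (2 + 2 * |t|) ^ n * Real.exp (-(a * |t|)) ≤
      n.factorial * (4 / a) ^ n * Real.exp (a / 2) * Real.exp (-(a / 2 * |t|)) := by
  have h := Real.pow_div_factorial_le_exp (a / 4 * (2 + 2 * |t|)) (by positivity) n
  rw [div_le_iff₀ (by positivity), mul_pow] at h
  have h2 : (2 + 2 * |t|) ^ n ≤ n.factorial * (4 / a) ^ n * Real.exp (a / 4 * (2 + 2 * |t|)) := by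
    have h3 : (4 / a) ^ n * (a / 4) ^ n = 1 := by
      rw [← mul_pow]
      field_simp
      simp
    calc (2 + 2 * |t|) ^ n = (4 / a) ^ n * ((a / 4) ^ n * (2 + 2 * |t|) ^ n) := by
          rw [← mul_assoc, h3, one_mul]
      _ ≤ (4 / a) ^ n * (Real.exp (a / 4 * (2 + 2 * |t|)) * n.factorial) := by gcongr
      _ = _ := by ring
  calc _ ≤ n.factorial * (4 / a) ^ n * Real.exp (a / 4 * (2 + 2 * |t|)) * Real.exp (-(a * |t|)) := by
        gcongr
    _ = _ := by
      rw [mul_assoc, mul_assoc _ (Real.exp (a / 2)), ← Real.exp_add, ← Real.exp_add]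
      ring_nf

lemma integrable_pow_mul_exp_neg_abs (n : ℕ) {a : ℝ} (ha : 0 < a) :
    Integrable fun t : ℝ => (2 + 2 * |t|) ^ n * Real.exp (-(a * |t|)) := by
  refine ((integrable_exp_neg_mul_abs (half_pos ha)).const_mul
    (n.factorial * (4 / a) ^ n * Real.exp (a / 2))).mono'
    (by fun_prop : Continuous _).aestronglyMeasurable (ae_of_all _ fun t => ?_)
  rw [Real.norm_of_nonneg (by positivity)]
  exact pow_mul_exp_neg_abs_le n ha t

/-- The values of `Γ(s) ζ(s)²` on the critical line. -/
def gammaZetaSq (t : ℝ) : ℂ :=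
  Complex.Gamma (1 / 2 + (t : ℂ) * Complex.I) * riemannZeta (1 / 2 + (t : ℂ) * Complex.I) ^ 2

lemma continuous_gammaZetaSq : Continuous gammaZetaSq := by
  refine Continuous.mul (continuous_iff_continuousAt.2 fun t => ?_) (continuous_zeta_half.pow 2)
  have h := (differentiableAt_Gamma_of_re_pos (half_mem_puncturedHalfPlane t).1).continuousAt
  exact ContinuousAt.comp (f := fun t : ℝ => 1 / 2 + (t : ℂ) * Complex.I) h (by fun_prop)

lemma sq_norm_Gamma_half (t : ℝ) :
    ‖Complex.Gamma (1 / 2 + (t : ℂ) * Complex.I)‖ ^ 2 = Real.pi / Real.cosh (Real.pi * t) := by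
  have h := Complex.Gamma_mul_Gamma_one_sub (1 / 2 + (t : ℂ) * Complex.I)
  have h1 : 1 - (1 / 2 + (t : ℂ) * Complex.I) = (starRingEnd ℂ) (1 / 2 + (t : ℂ) * Complex.I) := by
    simp [Complex.ext_iff]
    norm_num
  have h2 : Complex.sin (Real.pi * (1 / 2 + (t : ℂ) * Complex.I)) =
      ((Real.cosh (Real.pi * t) : ℝ) : ℂ) := by
    rw [show (Real.pi : ℂ) * (1 / 2 + (t : ℂ) * Complex.I) =
      (Real.pi * t : ℂ) * Complex.I + Real.pi / 2 by ring, Complex.sin_add_pi_div_two,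
      Complex.cos_mul_I]
    push_cast
    rfl
  rw [h1, Complex.Gamma_conj, Complex.mul_conj, Complex.normSq_eq_norm_sq, h2] at h
  exact_mod_cast h

lemma norm_Gamma_half_le (t : ℝ) :
    ‖Complex.Gamma (1 / 2 + (t : ℂ) * Complex.I)‖ ≤ 3 * Real.exp (-(Real.pi / 2 * |t|)) := by
  refine (pow_le_pow_iff_left₀ (norm_nonneg _) (by positivity) two_ne_zero).1 ?_
  rw [sq_norm_Gamma_half, mul_pow, ← Real.exp_nat_mul, div_le_iff₀ (Real.cosh_pos _)]
  have h1 : Real.exp (Real.pi * |t|) / 2 ≤ Real.cosh (Real.pi * t) := by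
    rw [← Real.cosh_abs, abs_mul, abs_of_pos Real.pi_pos, Real.cosh_eq]
    linarith [Real.exp_pos (-(Real.pi * |t|))]
  have h2 : Real.exp ((2 : ℕ) * -(Real.pi / 2 * |t|)) * Real.exp (Real.pi * |t|) = 1 := by
    rw [← Real.exp_add]
    push_cast
    ring_nf
    simp
  have h3 := Real.exp_pos ((2 : ℕ) * -(Real.pi / 2 * |t|))
  nlinarith [Real.pi_lt_four]

lemma norm_gammaZetaSq_le (t : ℝ) :
    ‖gammaZetaSq t‖ ≤ 3 * ((2 + 2 * |t|) ^ 2 * Real.exp (-(Real.pi / 2 * |t|))) := by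
  rw [gammaZetaSq, norm_mul, norm_pow]
  calc _ ≤ (3 * Real.exp (-(Real.pi / 2 * |t|))) * (2 + 2 * |t|) ^ 2 :=
        mul_le_mul (norm_Gamma_half_le t)
          (pow_le_pow_left₀ (norm_nonneg _) (norm_riemannZeta_half_le t) 2) (by positivity)
          (by positivity)
    _ = _ := by ring

/-- The Fourier-Laplace transform of `Γζ²` on the critical line. -/
def gammaZetaTransform (w : ℂ) : ℂ := ∫ t : ℝ, gammaZetaSq t * Complex.exp (-(t * Complex.I * w))

lemma norm_exp_mul_I_le {w : ℂ} {b : ℝ} (hw : |w.im| ≤ b) (t : ℝ) :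
    ‖Complex.exp (-(t * Complex.I * w))‖ ≤ Real.exp (b * |t|) := by
  rw [Complex.norm_exp]
  refine Real.exp_le_exp.2 ?_
  have : (-((t : ℂ) * Complex.I * w)).re = t * w.im := by simp
  rw [this]
  calc t * w.im ≤ |t * w.im| := le_abs_self _
    _ = |w.im| * |t| := by rw [abs_mul, mul_comm]
    _ ≤ b * |t| := by gcongr

lemma norm_gammaZetaSq_mul_exp_le {w : ℂ} {b : ℝ} (hw : |w.im| ≤ b) (t : ℝ) :
    ‖gammaZetaSq t * Complex.exp (-(t * Complex.I * w))‖ ≤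
      3 * ((2 + 2 * |t|) ^ 2 * Real.exp (-((Real.pi / 2 - b) * |t|))) := by
  rw [norm_mul]
  calc _ ≤ (3 * ((2 + 2 * |t|) ^ 2 * Real.exp (-(Real.pi / 2 * |t|)))) * Real.exp (b * |t|) :=
        mul_le_mul (norm_gammaZetaSq_le t) (norm_exp_mul_I_le hw t) (norm_nonneg _) (by positivity)
    _ = _ := by
      rw [mul_assoc, mul_assoc, ← Real.exp_add]
      ring_nf

lemma integrable_gammaZetaSq_mul_exp {w : ℂ} (hw : |w.im| < Real.pi / 2) :
    Integrable fun t : ℝ => gammaZetaSq t * Complex.exp (-(t * Complex.I * w)) :=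
  ((integrable_pow_mul_exp_neg_abs 2 (sub_pos.2 hw)).const_mul 3).mono'
    (continuous_gammaZetaSq.mul (by fun_prop)).aestronglyMeasurable
    (ae_of_all _ fun t => norm_gammaZetaSq_mul_exp_le le_rfl t)

lemma integrable_gammaZetaSq : Integrable gammaZetaSq := by
  simpa using integrable_gammaZetaSq_mul_exp (w := 0) (by simp; positivity)

lemma differentiableAt_gammaZetaTransform {w : ℂ} (hw : |w.im| < Real.pi / 2) :
    DifferentiableAt ℂ gammaZetaTransform w := by
  -- The width b leaves room both ways: |Im v| < b holds near w, and b < π/2 keeps one integrable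
  -- majorant for all these v.
  obtain ⟨b, hb1, hb2⟩ := exists_between hw
  have hs : {v : ℂ | |v.im| < b} ∈ 𝓝 w :=
    (isOpen_lt (continuous_abs.comp Complex.continuous_im) continuous_const).mem_nhds hb1
  have hcont : ∀ v : ℂ, Continuous fun t : ℝ => gammaZetaSq t * Complex.exp (-(t * Complex.I * v)) :=
    fun v => continuous_gammaZetaSq.mul (by fun_prop)
  refine (hasDerivAt_integral_of_dominated_loc_of_deriv_le (μ := volume) hs
    (F := fun (v : ℂ) (t : ℝ) => gammaZetaSq t * Complex.exp (-(t * Complex.I * v)))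
    (F' := fun (v : ℂ) (t : ℝ) =>
      gammaZetaSq t * Complex.exp (-(t * Complex.I * v)) * (-(t * Complex.I)))
    (bound := fun t => 3 * ((2 + 2 * |t|) ^ 3 * Real.exp (-((Real.pi / 2 - b) * |t|))))
    (Eventually.of_forall fun v => (hcont v).aestronglyMeasurable)
    (integrable_gammaZetaSq_mul_exp hw)
    ((hcont w).mul (by fun_prop)).aestronglyMeasurable ?_
    ((integrable_pow_mul_exp_neg_abs 3 (sub_pos.2 hb2)).const_mul 3) ?_).2.differentiableAt
  · refine ae_of_all _ fun t v hv => ?_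
    have hv : |v.im| < b := hv
    have h1 : ‖(-((t : ℂ) * Complex.I))‖ ≤ 2 + 2 * |t| := by
      simp
      linarith [abs_nonneg t]
    rw [norm_mul]
    calc _ ≤ (3 * ((2 + 2 * |t|) ^ 2 * Real.exp (-((Real.pi / 2 - b) * |t|)))) * (2 + 2 * |t|) :=
          mul_le_mul (norm_gammaZetaSq_mul_exp_le hv.le t) h1 (norm_nonneg _) (by positivity)
      _ = _ := by ring
  · refine ae_of_all _ fun t v _ => ?_
    have h1 : HasDerivAt (fun v : ℂ => -(t * Complex.I * v)) (-(t * Complex.I)) v := by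
      simpa using! ((hasDerivAt_id v).const_mul ((t : ℂ) * Complex.I)).neg
    simpa [mul_assoc] using h1.cexp.const_mul (gammaZetaSq t)

/-- Mellin inversion on Re s = 1/2 at x = e^w, where x^{-s} = e^{-w/2} e^{-itw}. -/
lemma gammaZetaTransform_ofReal (w : ℝ) :
    gammaZetaTransform w = 2 * Real.pi * (Complex.exp (w / 2) *
      (divisorSeries (Complex.exp w) -
        (Real.eulerMascheroniConstant - w) * Complex.exp (-w))) := by
  have hx : 0 < Real.exp w := Real.exp_pos w
  have hm : ∀ t : ℝ, mellin divisorRemainder (((1 / 2 : ℝ) : ℂ) + t * Complex.I) = gammaZetaSq t := by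
    intro t
    have h := half_mem_puncturedHalfPlane t
    have e : ((1 / 2 : ℝ) : ℂ) = 1 / 2 := by push_cast; rfl
    rw [e, (hasMellin_divisorRemainder h.1 (by simp; norm_num)).2, gammaZetaSq]
  have hcont : ContinuousAt divisorRemainder (Real.exp w) := by
    refine ContinuousAt.sub
      (continuousOn_realDivisorSeries_ofReal.continuousAt (Ioi_mem_nhds hx)) ?_
    refine Complex.continuous_ofReal.continuousAt.comp ?_
    exact (continuousAt_const.sub (Real.continuousAt_log hx.ne')).div continuousAt_id hx.ne'
  have h := mellinInv_mellin_eq (1 / 2) divisorRemainder hx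
    (hasMellin_divisorRemainder (by simp) (by simp; norm_num)).1
    (by simpa only [Complex.VerticalIntegrable, hm] using integrable_gammaZetaSq) hcont
  rw [mellinInv] at h
  simp_rw [hm] at h
  have hexp : ∀ t : ℝ, ((Real.exp w : ℝ) : ℂ) ^ (-(((1 / 2 : ℝ) : ℂ) + t * Complex.I)) •
      gammaZetaSq t =
      Complex.exp (-(w / 2)) * (gammaZetaSq t * Complex.exp (-(t * Complex.I * w))) := fun t => by
    rw [Complex.cpow_def_of_ne_zero (by exact_mod_cast hx.ne'), ← Complex.ofReal_log hx.le,
      Real.log_exp, smul_eq_mul, mul_left_comm, ← Complex.exp_add, mul_comm]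
    congr 2
    push_cast
    ring
  simp_rw [hexp] at h
  rw [integral_const_mul, Complex.real_smul] at h
  have h2 : divisorRemainder (Real.exp w) = divisorSeries (Complex.exp w) -
      (Real.eulerMascheroniConstant - w) * Complex.exp (-w) := by
    rw [divisorRemainder, ← divisorSeries_ofReal, Real.log_exp, Complex.exp_neg]
    push_cast
    rfl
  rw [← h2, ← h, gammaZetaTransform, Complex.exp_neg]
  have := Complex.exp_ne_zero ((w : ℂ) / 2)
  have hpi : (Real.pi : ℂ) ≠ 0 := by exact_mod_cast Real.pi_ne_zero
  generalize (∫ t : ℝ, gammaZetaSq t * Complex.exp (-(t * Complex.I * w))) = J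
  push_cast
  field_simp

lemma re_exp_pos {w : ℂ} (hw : |w.im| < Real.pi / 2) : 0 < (Complex.exp w).re := by
  rw [Complex.exp_re]
  exact mul_pos (Real.exp_pos _) (Real.cos_pos_of_mem_Ioo (abs_lt.1 hw |>.imp (by simp) id))

lemma gammaZetaTransform_eq {w : ℂ} (hw : |w.im| < Real.pi / 2) :
    gammaZetaTransform w = 2 * Real.pi * (Complex.exp (w / 2) *
      (divisorSeries (Complex.exp w) -
        (Real.eulerMascheroniConstant - w) * Complex.exp (-w))) := by
  set U : Set ℂ := {w : ℂ | |w.im| < Real.pi / 2} with hU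
  have hopen : IsOpen U :=
    isOpen_lt (continuous_abs.comp Complex.continuous_im) continuous_const
  have hconv : IsPreconnected U := by
    have : U = {w : ℂ | -(Real.pi / 2) < w.im} ∩ {w : ℂ | w.im < Real.pi / 2} := by
      ext w
      simp [hU, abs_lt]
    rw [this]
    exact ((convex_halfSpace_im_gt _).inter (convex_halfSpace_im_lt _)).isPreconnected
  have hf : DifferentiableOn ℂ gammaZetaTransform U := fun w hw =>
    (differentiableAt_gammaZetaTransform hw).differentiableWithinAt
  have hg : DifferentiableOn ℂ (fun w : ℂ => 2 * Real.pi * (Complex.exp (w / 2) *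
      (divisorSeries (Complex.exp w) -
        (Real.eulerMascheroniConstant - w) * Complex.exp (-w)))) U := by
    have h1 : DifferentiableOn ℂ (fun w => divisorSeries (Complex.exp w)) U :=
      differentiableOn_divisorSeries.comp (by fun_prop) fun w hw => re_exp_pos hw
    fun_prop
  -- Both sides are holomorphic in the strip and agree on the real axis, which accumulates at 0.
  refine (hf.analyticOnNhd hopen).eqOn_of_preconnected_of_frequently_eq (hg.analyticOnNhd hopen)
    hconv (z₀ := 0) (by simp [hU]; positivity) ?_ hw
  have hof : Tendsto (fun s : ℝ => (s : ℂ)) (𝓝[≠] 0) (𝓝[≠] 0) := by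
    refine tendsto_nhdsWithin_iff.2 ⟨?_, ?_⟩
    · exact (Complex.continuous_ofReal.tendsto' 0 0 (by simp)).mono_left nhdsWithin_le_nhds
    · filter_upwards [self_mem_nhdsWithin] with s hs
      simpa using hs
  exact hof.frequently (Eventually.of_forall gammaZetaTransform_ofReal).frequently

/-! ### The functional equation and the Laplace transform of |ζ|² -/

/-- The point `log (2π e^{i(π/2 - 2δ)})`. -/
def ladderPoint (δ : ℝ) : ℂ := (Real.log (2 * Real.pi) : ℂ) + ((Real.pi / 2 - 2 * δ : ℝ) : ℂ) * Complex.I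

lemma abs_im_ladderPoint_lt {δ : ℝ} (h0 : 0 < δ) (h1 : δ < Real.pi / 2) :
    |(ladderPoint δ).im| < Real.pi / 2 := by
  have : (ladderPoint δ).im = Real.pi / 2 - 2 * δ := by simp [ladderPoint]
  rw [this, abs_lt]
  constructor <;> linarith

lemma exp_log_two_pi : Complex.exp (Real.log (2 * Real.pi) : ℂ) = 2 * Real.pi := by
  rw [← Complex.ofReal_exp, Real.exp_log (by positivity)]
  push_cast
  rfl

lemma one_add_I_mul_exp_ne_zero (x : ℝ) : 1 + Complex.I * (Real.exp x : ℂ) ≠ 0 := fun h => by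
  have := congrArg Complex.re h
  simp at this

lemma riemannZeta_mul_conj_half (t : ℝ) :
    riemannZeta (1 - (1 / 2 + (t : ℂ) * Complex.I)) * riemannZeta (1 / 2 + (t : ℂ) * Complex.I) =
      (zetaSq t : ℂ) := by
  have h1 : 1 - (1 / 2 + (t : ℂ) * Complex.I) = (starRingEnd ℂ) (1 / 2 + (t : ℂ) * Complex.I) := by
    simp [Complex.ext_iff]
    norm_num
  rw [h1, riemannZeta_conj, mul_comm, Complex.mul_conj, Complex.normSq_eq_norm_sq, zetaSq]

/-- The functional equation on the critical line. -/
lemma gammaZetaSq_mul_eq (t : ℝ) :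
    gammaZetaSq t * (Complex.exp (-(t * Complex.I * Real.log (2 * Real.pi))) *
      Complex.exp (Real.pi / 2 * t)) * (1 + Complex.I * (Real.exp (-(Real.pi * t)) : ℂ)) =
    Complex.exp (Real.log (2 * Real.pi) / 2 + Real.pi / 4 * Complex.I) * zetaSq t := by
  set s : ℂ := 1 / 2 + (t : ℂ) * Complex.I with hs
  have h := riemannZeta_one_sub (s := s) (fun n h => by
    have := congrArg Complex.re h
    simp [hs] at this
    linarith [(n.cast_nonneg : (0 : ℝ) ≤ n), show (0 : ℝ) < 2⁻¹ by norm_num])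
    (half_mem_puncturedHalfPlane t).2
  have h2 : (2 * Real.pi : ℂ) ^ (-s) = Complex.exp (-(Real.log (2 * Real.pi) / 2)) *
      Complex.exp (-(t * Complex.I * Real.log (2 * Real.pi))) := by
    have hpi : (2 * Real.pi : ℂ) ≠ 0 := by simp [Real.pi_ne_zero]
    rw [Complex.cpow_def_of_ne_zero hpi, ← Complex.exp_add]
    have : Complex.log (2 * Real.pi) = Real.log (2 * Real.pi) := by
      rw [Complex.ofReal_log (by positivity)]
      push_cast
      rfl
    rw [this, hs]
    ring_nf
  -- The exponential growing as t → +∞ is taken out of the cosine. It is the factor produced by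
  -- rotating the argument towards π/2, and the other exponential becomes i e^{-πt}.
  have h3 : 2 * Complex.cos (Real.pi * s / 2) = Complex.exp (-(Real.pi / 4 * Complex.I)) *
      Complex.exp (Real.pi / 2 * t) * (1 + Complex.I * (Real.exp (-(Real.pi * t)) : ℂ)) := by
    have hI : Complex.I = Complex.exp (Real.pi / 2 * Complex.I) := Complex.exp_pi_div_two_mul_I.symm
    have e1 : Complex.exp (-(Real.pi / 4 * Complex.I)) * Complex.exp (Real.pi / 2 * t) *
        (Complex.I * (Real.exp (-(Real.pi * t)) : ℂ)) = Complex.exp (Real.pi * s / 2 * Complex.I) := by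
      nth_rewrite 2 [hI]
      push_cast
      rw [← Complex.exp_add, ← Complex.exp_add, ← Complex.exp_add, hs]
      congr 1
      linear_combination (-(Real.pi : ℂ) * t / 2) * Complex.I_sq
    have e2 : Complex.exp (-(Real.pi / 4 * Complex.I)) * Complex.exp (Real.pi / 2 * t) =
        Complex.exp (-(Real.pi * s / 2 * Complex.I)) := by
      rw [← Complex.exp_add, hs]
      congr 1
      linear_combination ((Real.pi : ℂ) * t / 2) * Complex.I_sq
    rw [mul_add (Complex.exp _ * Complex.exp _), e1, mul_one, e2, Complex.cos]
    ring_nf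
  have h4 : (zetaSq t : ℂ) = Complex.exp (-(Real.log (2 * Real.pi) / 2)) *
      Complex.exp (-(Real.pi / 4 * Complex.I)) *
      (gammaZetaSq t * (Complex.exp (-(t * Complex.I * Real.log (2 * Real.pi))) *
      Complex.exp (Real.pi / 2 * t)) * (1 + Complex.I * (Real.exp (-(Real.pi * t)) : ℂ))) := by
    rw [← riemannZeta_mul_conj_half, ← hs, h, gammaZetaSq, ← hs]
    calc _ = (2 * Real.pi : ℂ) ^ (-s) * (2 * Complex.cos (Real.pi * s / 2)) *
          (Complex.Gamma s * riemannZeta s ^ 2) := by ring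
      _ = _ := by
        rw [h2, h3]
        ring
  rw [h4, Complex.exp_add, Complex.exp_neg (_ / 2), Complex.exp_neg (_ * Complex.I)]
  have n1 := Complex.exp_ne_zero ((Real.log (2 * Real.pi) : ℂ) / 2)
  have n2 := Complex.exp_ne_zero ((Real.pi : ℂ) / 4 * Complex.I)
  field_simp

lemma gammaZetaSq_mul_exp_ladderPoint (δ t : ℝ) :
    gammaZetaSq t * Complex.exp (-(t * Complex.I * ladderPoint δ)) =
      Complex.exp (Real.log (2 * Real.pi) / 2 + Real.pi / 4 * Complex.I) *
      ((zetaSq t * Real.exp (-(2 * δ * t)) : ℝ) / (1 + Complex.I * (Real.exp (-(Real.pi * t)) : ℂ))) := by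
  rw [← mul_div_assoc, eq_div_iff (one_add_I_mul_exp_ne_zero _), Complex.ofReal_mul, ← mul_assoc,
    ← gammaZetaSq_mul_eq]
  have : Complex.exp (-(t * Complex.I * ladderPoint δ)) =
      Complex.exp (-(t * Complex.I * Real.log (2 * Real.pi))) *
      Complex.exp (Real.pi / 2 * t) * (Real.exp (-(2 * δ * t)) : ℂ) := by
    push_cast
    rw [← Complex.exp_add, ← Complex.exp_add, ladderPoint]
    congr 1
    push_cast
    linear_combination (-(t : ℂ) * (Real.pi / 2 - 2 * δ)) * Complex.I_sq
  rw [this]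
  ring

lemma integral_zetaSq_div_one_add_I {δ : ℝ} (h0 : 0 < δ) (h1 : δ < Real.pi / 2) :
    ∫ t : ℝ, ((zetaSq t * Real.exp (-(2 * δ * t)) : ℝ) : ℂ) /
        (1 + Complex.I * (Real.exp (-(Real.pi * t)) : ℂ)) =
      2 * Real.pi * (Complex.exp (-(δ * Complex.I)) * (divisorSeries (Complex.exp (ladderPoint δ)) -
        (Real.eulerMascheroniConstant - ladderPoint δ) * Complex.exp (-ladderPoint δ))) := by
  have h := gammaZetaTransform_eq (abs_im_ladderPoint_lt h0 h1)
  rw [gammaZetaTransform] at h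
  simp_rw [gammaZetaSq_mul_exp_ladderPoint] at h
  rw [integral_const_mul] at h
  -- Half the ladder point reproduces the constant of the functional equation up to e^{-iδ}, so that
  -- constant cancels from both sides.
  have e : Complex.exp (ladderPoint δ / 2) =
      Complex.exp (Real.log (2 * Real.pi) / 2 + Real.pi / 4 * Complex.I) *
      Complex.exp (-(δ * Complex.I)) := by
    rw [← Complex.exp_add, ladderPoint]
    congr 1
    push_cast
    ring
  rw [e] at h
  refine mul_left_cancel₀
    (Complex.exp_ne_zero (Real.log (2 * Real.pi) / 2 + Real.pi / 4 * Complex.I)) (h.trans ?_)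
  ring

lemma integrable_zetaSq_div_one_add_I {δ : ℝ} (h0 : 0 < δ) (h1 : δ < Real.pi / 2) :
    Integrable fun t : ℝ => ((zetaSq t * Real.exp (-(2 * δ * t)) : ℝ) : ℂ) /
        (1 + Complex.I * (Real.exp (-(Real.pi * t)) : ℂ)) := by
  have h := integrable_gammaZetaSq_mul_exp (abs_im_ladderPoint_lt h0 h1)
  simp_rw [gammaZetaSq_mul_exp_ladderPoint] at h
  exact (integrable_const_mul_iff
    (isUnit_iff_ne_zero.2 (Complex.exp_ne_zero _)) _).1 h

lemma re_div_one_add_I_mul (x a : ℝ) :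
    ((x : ℂ) / (1 + Complex.I * (a : ℂ))).re = x / (1 + a ^ 2) := by
  rw [Complex.div_re]
  simp [Complex.normSq_apply]
  ring

lemma re_zetaSq_div (δ t : ℝ) :
    (((zetaSq t * Real.exp (-(2 * δ * t)) : ℝ) : ℂ) /
      (1 + Complex.I * (Real.exp (-(Real.pi * t)) : ℂ))).re =
      zetaSq t * Real.exp (-(2 * δ * t)) / (1 + Real.exp (-(2 * Real.pi * t))) := by
  rw [re_div_one_add_I_mul, ← Real.exp_nat_mul]
  push_cast
  ring_nf

lemma integral_zetaSq_div {δ : ℝ} (h0 : 0 < δ) (h1 : δ < Real.pi / 2) :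
    Integrable (fun t : ℝ => zetaSq t * Real.exp (-(2 * δ * t)) /
        (1 + Real.exp (-(2 * Real.pi * t)))) ∧
    ∫ t : ℝ, zetaSq t * Real.exp (-(2 * δ * t)) / (1 + Real.exp (-(2 * Real.pi * t))) =
      2 * Real.pi * (Complex.exp (-(δ * Complex.I)) * (divisorSeries (Complex.exp (ladderPoint δ)) -
        (Real.eulerMascheroniConstant - ladderPoint δ) * Complex.exp (-ladderPoint δ))).re := by
  have hi := integrable_zetaSq_div_one_add_I h0 h1
  have h2 := hi.re
  have h3 := integral_re hi
  simp only [RCLike.re_to_complex, re_zetaSq_div] at h2 h3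
  refine ⟨h2, h3.trans ?_⟩
  rw [integral_zetaSq_div_one_add_I h0 h1, ← Complex.re_ofReal_mul]
  push_cast
  rfl

lemma integrableOn_zetaSq_mul_exp {a : ℝ} (ha : 0 < a) :
    IntegrableOn (fun t => zetaSq t * Real.exp (-(a * t))) (Ioi 0) := by
  refine ((integrable_pow_mul_exp_neg_abs 2 ha).integrableOn (s := Ioi 0)).mono'
    (continuous_zetaSq.mul (by fun_prop)).aestronglyMeasurable ?_
  refine (ae_restrict_iff' measurableSet_Ioi).2 (ae_of_all _ fun t ht => ?_)
  rw [Real.norm_of_nonneg (mul_nonneg (zetaSq_nonneg t) (Real.exp_pos _).le)]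
  have := zetaSq_le t
  rw [abs_of_pos (mem_Ioi.1 ht)] at this ⊢
  gcongr

/-- The contribution of the negative half line. -/
def reflectedPart (δ t : ℝ) : ℝ :=
  zetaSq t * (Real.exp (2 * δ * t) - Real.exp (-(2 * δ * t))) / (1 + Real.exp (2 * Real.pi * t))

lemma continuous_reflectedPart (δ : ℝ) : Continuous (reflectedPart δ) := by
  refine Continuous.div (continuous_zetaSq.mul (by fun_prop)) (by fun_prop) fun t => ?_
  positivity

lemma norm_reflectedPart_le {δ t : ℝ} (h0 : 0 < δ) (h1 : δ < 1) (ht : 0 < t) :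
    ‖reflectedPart δ t‖ ≤ (2 + 2 * |t|) ^ 2 * Real.exp (-(1 * |t|)) := by
  have h2 : Real.exp (-(2 * δ * t)) ≤ Real.exp (2 * δ * t) := Real.exp_le_exp.2 (by nlinarith)
  have h3 : Real.exp (2 * δ * t) ≤ Real.exp (2 * t) := Real.exp_le_exp.2 (by nlinarith)
  rw [reflectedPart, Real.norm_of_nonneg (div_nonneg (mul_nonneg (zetaSq_nonneg t) (by linarith))
    (by positivity)), div_le_iff₀ (by positivity)]
  calc _ ≤ (2 + 2 * |t|) ^ 2 * Real.exp (2 * t) := by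
        refine mul_le_mul (zetaSq_le t) ?_ (by linarith) (by positivity)
        linarith [Real.exp_pos (-(2 * δ * t))]
    _ ≤ (2 + 2 * |t|) ^ 2 * Real.exp (-(1 * |t|)) * Real.exp (2 * Real.pi * t) := by
        rw [mul_assoc, ← Real.exp_add, abs_of_pos ht]
        gcongr
        nlinarith [Real.pi_gt_three]
    _ ≤ _ := by
        gcongr
        linarith

lemma integrableOn_reflectedPart {δ : ℝ} (h0 : 0 < δ) (h1 : δ < 1) :
    IntegrableOn (reflectedPart δ) (Ioi 0) :=
  ((integrable_pow_mul_exp_neg_abs 2 one_pos).integrableOn (s := Ioi 0)).mono'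
    (continuous_reflectedPart δ).aestronglyMeasurable
    ((ae_restrict_iff' measurableSet_Ioi).2 (ae_of_all _ fun _ ht => norm_reflectedPart_le h0 h1 ht))

lemma tendsto_integral_reflectedPart :
    Tendsto (fun δ => ∫ t in Ioi 0, reflectedPart δ t) (𝓝[>] 0) (𝓝 0) := by
  have h : Tendsto (fun δ => ∫ t in Ioi 0, reflectedPart δ t) (𝓝[>] 0)
      (𝓝 (∫ t in Ioi (0 : ℝ), (0 : ℝ))) := by
    refine tendsto_integral_filter_of_dominated_convergence
      (fun t => (2 + 2 * |t|) ^ 2 * Real.exp (-(1 * |t|)))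
      (Eventually.of_forall fun δ => (continuous_reflectedPart δ).aestronglyMeasurable) ?_
      (integrable_pow_mul_exp_neg_abs 2 one_pos).integrableOn (ae_of_all _ fun t => ?_)
    · filter_upwards [Ioo_mem_nhdsGT one_pos] with δ hδ
      exact (ae_restrict_iff' measurableSet_Ioi).2
        (ae_of_all _ fun t ht => norm_reflectedPart_le hδ.1 hδ.2 ht)
    · have hc : Continuous fun δ => reflectedPart δ t := by
        unfold reflectedPart
        fun_prop
      exact (hc.tendsto' 0 0 (by simp [reflectedPart])).mono_left nhdsWithin_le_nhds
  simpa using h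

/-- The weights 1/(1 + e^{-2πt}) and 1/(1 + e^{2πt}) add to 1, so e^{-2δt} is recovered with full
weight. The excess decays exponentially in t and vanishes at δ = 0. -/
lemma zetaSq_div_add_reflection (δ t : ℝ) :
    zetaSq t * Real.exp (-(2 * δ * t)) / (1 + Real.exp (-(2 * Real.pi * t))) +
      zetaSq (-t) * Real.exp (-(2 * δ * -t)) / (1 + Real.exp (-(2 * Real.pi * -t))) =
    zetaSq t * Real.exp (-(2 * δ * t)) + reflectedPart δ t := by
  rw [zetaSq_neg, reflectedPart, mul_neg, mul_neg, neg_neg, neg_neg, Real.exp_neg (2 * Real.pi * t)]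
  have := Real.exp_pos (2 * Real.pi * t)
  field_simp
  ring

lemma integral_zetaSq_mul_exp_add {δ : ℝ} (h0 : 0 < δ) (h1 : δ < 1) :
    (∫ t in Ioi 0, zetaSq t * Real.exp (-(2 * δ * t))) + ∫ t in Ioi 0, reflectedPart δ t =
      2 * Real.pi * (Complex.exp (-(δ * Complex.I)) * (divisorSeries (Complex.exp (ladderPoint δ)) -
        (Real.eulerMascheroniConstant - ladderPoint δ) * Complex.exp (-ladderPoint δ))).re := by
  obtain ⟨hi, he⟩ := integral_zetaSq_div h0 (show δ < Real.pi / 2 by linarith [Real.pi_gt_three])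
  rw [← he, ← integral_add (integrableOn_zetaSq_mul_exp (by positivity))
    (integrableOn_reflectedPart h0 h1), ← integral_add_compl measurableSet_Ioi hi, compl_Ioi,
    ← neg_zero, ← integral_comp_neg_Ioi, neg_zero, ← integral_add hi.integrableOn]
  · exact setIntegral_congr_fun measurableSet_Ioi fun t _ => (zetaSq_div_add_reflection δ t).symm
  · exact hi.comp_neg.integrableOn

/-! ### The divisor series near 2πi and the value of the constant -/

lemma summable_cos_mul_exp {u : ℝ} (hu : 0 < u) (v : ℝ) : Summable fun p : ℕ × ℕ =>
    Complex.exp (-((((p.1 + 1) * (p.2 + 1) : ℕ) : ℂ) * ((u : ℂ) - v * Complex.I))) := by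
  refine Summable.of_norm ((summable_realDivisorSeries hu).congr fun p => ?_)
  rw [Complex.norm_exp, Complex.neg_re, ← Complex.ofReal_natCast, Complex.re_ofReal_mul]
  simp

lemma exp_term_eq (N : ℕ) (u v : ℝ) :
    Complex.exp (-((N : ℂ) * ((u : ℂ) - v * Complex.I))) =
      (Real.exp (-(N * u)) : ℂ) * (Real.cos (N * v) + Real.sin (N * v) * Complex.I) := by
  rw [Complex.ofReal_cos, Complex.ofReal_sin, ← Complex.exp_mul_I, Complex.ofReal_exp,
    ← Complex.exp_add]
  congr 1
  push_cast
  ring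

lemma re_exp_term (N : ℕ) (u v : ℝ) :
    (Complex.exp (-((N : ℂ) * ((u : ℂ) - v * Complex.I)))).re =
      Real.exp (-(N * u)) * Real.cos (N * v) := by
  rw [exp_term_eq, Complex.re_ofReal_mul]
  simp only [Complex.add_re, Complex.ofReal_re, Complex.mul_re, Complex.I_re, Complex.ofReal_im,
    Complex.I_im]
  ring

lemma im_exp_term (N : ℕ) (u v : ℝ) :
    (Complex.exp (-((N : ℂ) * ((u : ℂ) - v * Complex.I)))).im =
      Real.exp (-(N * u)) * Real.sin (N * v) := by
  rw [exp_term_eq, Complex.im_ofReal_mul]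
  simp only [Complex.add_im, Complex.ofReal_im, Complex.mul_im, Complex.I_re, Complex.ofReal_re,
    Complex.I_im]
  ring

/-- Termwise 1 - cos(Nv) ≤ (Nv)²/2, so the second moment controls the difference; the exponent is 2
+ 3/2. -/
lemma exists_abs_re_divisorSeries_sub_le : ∃ C : ℝ, 0 ≤ C ∧ ∀ u v : ℝ, 0 < u →
    |(divisorSeries ((u : ℂ) - v * Complex.I)).re - realDivisorSeries u| ≤
      C * v ^ 2 / u ^ (7 / 2 : ℝ) := by
  obtain ⟨C, hC0, hC⟩ := exists_moment_le 2
  refine ⟨C, hC0, fun u v hu => ?_⟩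
  have h1 := summable_cos_mul_exp hu v
  have h2 := (summable_moment 2 hu).mul_right (v ^ 2)
  have h3 : Summable fun p : ℕ × ℕ =>
      (Complex.exp (-((((p.1 + 1) * (p.2 + 1) : ℕ) : ℂ) * ((u : ℂ) - v * Complex.I)))).re :=
    Complex.reCLM.summable h1
  rw [divisorSeries, Complex.re_tsum h1, realDivisorSeries,
    ← h3.tsum_sub (summable_realDivisorSeries hu), ← Real.norm_eq_abs]
  refine (tsum_of_norm_bounded h2.hasSum fun p => ?_).trans ?_
  · simp only [re_exp_term]
    generalize (p.1 + 1) * (p.2 + 1) = N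
    have hc1 := Real.one_sub_sq_div_two_le_cos (x := N * v)
    have hc2 := Real.cos_le_one (N * v)
    rw [Real.norm_eq_abs, ← mul_sub_one, abs_mul, abs_of_pos (Real.exp_pos _), mul_right_comm,
      mul_comm]
    refine mul_le_mul_of_nonneg_right ?_ (Real.exp_pos _).le
    rw [abs_of_nonpos (by linarith)]
    nlinarith [sq_nonneg ((N : ℝ) * v)]
  · rw [tsum_mul_right]
    have := hC u hu
    norm_num at this
    calc _ ≤ C / u ^ (7 / 2 : ℝ) * v ^ 2 := by
          refine mul_le_mul_of_nonneg_right ?_ (sq_nonneg v)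
          simpa using this
      _ = _ := by ring

lemma exists_abs_im_divisorSeries_le : ∃ C : ℝ, 0 ≤ C ∧ ∀ u v : ℝ, 0 < u →
    |(divisorSeries ((u : ℂ) - v * Complex.I)).im| ≤ C * |v| / u ^ (5 / 2 : ℝ) := by
  obtain ⟨C, hC0, hC⟩ := exists_moment_le 1
  refine ⟨C, hC0, fun u v hu => ?_⟩
  have h1 := summable_cos_mul_exp hu v
  have h2 := (summable_moment 1 hu).mul_right |v|
  rw [divisorSeries, Complex.im_tsum h1, ← Real.norm_eq_abs]
  refine (tsum_of_norm_bounded h2.hasSum fun p => ?_).trans ?_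
  · simp only [im_exp_term]
    generalize (p.1 + 1) * (p.2 + 1) = N
    have hs := Real.abs_sin_le_abs (x := N * v)
    rw [Real.norm_eq_abs, abs_mul, abs_of_pos (Real.exp_pos _), mul_right_comm, mul_comm,
      pow_one]
    refine mul_le_mul_of_nonneg_right ?_ (Real.exp_pos _).le
    rwa [abs_mul (N : ℝ), Nat.abs_cast] at hs
  · rw [tsum_mul_right]
    have := hC u hu
    norm_num at this
    calc _ ≤ C / u ^ (5 / 2 : ℝ) * |v| := by
          refine mul_le_mul_of_nonneg_right ?_ (abs_nonneg v)
          simpa using this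
      _ = _ := by ring

/-- With cos 2δ = 1 - 2 sin²δ the point is 2πi plus a small number, and the series has period 2πi.
-/
lemma divisorSeries_exp_ladderPoint (δ : ℝ) :
    divisorSeries (Complex.exp (ladderPoint δ)) =
      divisorSeries (((2 * Real.pi * Real.sin (2 * δ) : ℝ) : ℂ) -
        ((4 * Real.pi * Real.sin δ ^ 2 : ℝ) : ℂ) * Complex.I) := by
  have h : Complex.exp (ladderPoint δ) = (((2 * Real.pi * Real.sin (2 * δ) : ℝ) : ℂ) -
      ((4 * Real.pi * Real.sin δ ^ 2 : ℝ) : ℂ) * Complex.I) + 2 * Real.pi * Complex.I := by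
    rw [ladderPoint, Complex.exp_add, exp_log_two_pi, Complex.exp_mul_I, ← Complex.ofReal_cos,
      ← Complex.ofReal_sin, Real.cos_pi_div_two_sub, Real.sin_pi_div_two_sub, Real.cos_two_mul,
      Real.cos_sq']
    push_cast
    ring
  rw [h]
  refine tsum_congr fun p => ?_
  generalize (p.1 + 1) * (p.2 + 1) = N
  rw [mul_add, neg_add, Complex.exp_add]
  have : Complex.exp (-((N : ℂ) * (2 * Real.pi * Complex.I))) = 1 := by
    rw [Complex.exp_neg, Complex.exp_nat_mul_two_pi_mul_I, inv_one]
  rw [this, mul_one]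

lemma two_pi_mul_sin_ge {δ : ℝ} (h0 : 0 < δ) (h1 : δ < 1 / 2) :
    δ ≤ 2 * Real.pi * Real.sin (2 * δ) := by
  have h := Real.mul_le_sin (x := 2 * δ) (by linarith) (by linarith [Real.pi_gt_three])
  have h2 : 2 * Real.pi * (2 / Real.pi * (2 * δ)) = 8 * δ := by
    have := Real.pi_ne_zero
    field_simp
    norm_num
  have h3 := mul_le_mul_of_nonneg_left h (show 0 ≤ 2 * Real.pi by positivity)
  linarith

lemma four_pi_mul_sin_sq_le {δ : ℝ} (h0 : 0 < δ) : 4 * Real.pi * Real.sin δ ^ 2 ≤ 16 * δ ^ 2 := by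
  have h : Real.sin δ ^ 2 ≤ δ ^ 2 := by
    rw [sq_le_sq, abs_of_pos h0]
    simpa [abs_of_pos h0] using Real.abs_sin_le_abs (x := δ)
  nlinarith [Real.pi_lt_four, Real.pi_pos, sq_nonneg (Real.sin δ)]

lemma tendsto_const_mul_rpow_half (C : ℝ) :
    Tendsto (fun δ : ℝ => C * δ ^ (1 / 2 : ℝ)) (𝓝[>] 0) (𝓝 0) := by
  have : Continuous fun δ : ℝ => C * δ ^ (1 / 2 : ℝ) :=
    continuous_const.mul (Real.continuous_rpow_const (by norm_num))
  exact (this.tendsto' 0 0 (by simp)).mono_left nhdsWithin_le_nhds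

lemma tendsto_re_divisorSeries_sub :
    Tendsto (fun δ : ℝ => (divisorSeries (Complex.exp (ladderPoint δ))).re -
      realDivisorSeries (2 * Real.pi * Real.sin (2 * δ))) (𝓝[>] 0) (𝓝 0) := by
  obtain ⟨C, hC0, hC⟩ := exists_abs_re_divisorSeries_sub_le
  refine squeeze_zero_norm' ?_ (tendsto_const_mul_rpow_half (256 * C))
  filter_upwards [Ioo_mem_nhdsGT (show (0 : ℝ) < 1 / 2 by norm_num)] with δ hδ
  have hu := two_pi_mul_sin_ge hδ.1 hδ.2
  have hv := four_pi_mul_sin_sq_le hδ.1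
  have h0 := hδ.1
  rw [divisorSeries_exp_ladderPoint, Real.norm_eq_abs]
  refine (hC _ _ (h0.trans_le hu)).trans ?_
  -- Here v² = O(δ⁴) against u^{7/2} ≥ δ^{7/2}, which leaves δ^{1/2}.
  calc _ ≤ C * (16 * δ ^ 2) ^ 2 / δ ^ (7 / 2 : ℝ) := by gcongr
    _ = 256 * C * (δ ^ ((4 : ℕ) : ℝ) / δ ^ (7 / 2 : ℝ)) := by
      rw [Real.rpow_natCast]
      ring
    _ = _ := by
      rw [← Real.rpow_sub h0]
      norm_num

lemma tendsto_sin_mul_im_divisorSeries :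
    Tendsto (fun δ : ℝ => Real.sin δ * (divisorSeries (Complex.exp (ladderPoint δ))).im)
      (𝓝[>] 0) (𝓝 0) := by
  obtain ⟨C, hC0, hC⟩ := exists_abs_im_divisorSeries_le
  refine squeeze_zero_norm' ?_ (tendsto_const_mul_rpow_half (16 * C))
  filter_upwards [Ioo_mem_nhdsGT (show (0 : ℝ) < 1 / 2 by norm_num)] with δ hδ
  have hu := two_pi_mul_sin_ge hδ.1 hδ.2
  have hv := four_pi_mul_sin_sq_le hδ.1
  have h0 := hδ.1
  have hs : |Real.sin δ| ≤ δ := by simpa [abs_of_pos h0] using Real.abs_sin_le_abs (x := δ)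
  rw [divisorSeries_exp_ladderPoint, norm_mul, Real.norm_eq_abs, Real.norm_eq_abs]
  calc _ ≤ δ * (C * |4 * Real.pi * Real.sin δ ^ 2| / (2 * Real.pi * Real.sin (2 * δ)) ^ (5 / 2 : ℝ)) :=
        mul_le_mul hs (hC _ _ (h0.trans_le hu)) (abs_nonneg _) h0.le
    _ ≤ δ * (C * (16 * δ ^ 2) / δ ^ (5 / 2 : ℝ)) := by
        rw [abs_of_nonneg (show 0 ≤ 4 * Real.pi * Real.sin δ ^ 2 by positivity)]
        gcongr
    _ = 16 * C * (δ ^ ((3 : ℕ) : ℝ) / δ ^ (5 / 2 : ℝ)) := by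
      rw [Real.rpow_natCast]
      ring
    _ = _ := by
      rw [← Real.rpow_sub h0]
      norm_num

/-- The ratio 2δ/sin 2δ is 1 + O(δ²), so its logarithm divided by 2 sin δ is O(δ). -/
lemma tendsto_log_sub_log_div_sin :
    Tendsto (fun δ : ℝ => (Real.log (4 * Real.pi * δ) - Real.log (2 * Real.pi * Real.sin (2 * δ))) /
      (2 * Real.sin δ)) (𝓝[>] 0) (𝓝 0) := by
  have hlim : Tendsto (fun δ : ℝ => 2 * δ) (𝓝[>] 0) (𝓝 0) :=
    ((continuous_const.mul continuous_id).tendsto' 0 0 (by simp)).mono_left nhdsWithin_le_nhds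
  refine squeeze_zero_norm' ?_ hlim
  filter_upwards [Ioo_mem_nhdsGT (show (0 : ℝ) < 1 / 2 by norm_num)] with δ hδ
  have h0 := hδ.1
  have h1 := hδ.2
  have hs := Real.sin_pos_of_pos_of_lt_pi (x := 2 * δ) (by linarith) (by linarith [Real.pi_gt_three])
  have hlt := Real.sin_lt (x := 2 * δ) (by linarith)
  have hgt := Real.sin_gt_sub_cube (x := 2 * δ) (by linarith)
  have hsd := Real.sin_gt_sub_cube (x := δ) h0
  have hsd2 : δ / 2 ≤ Real.sin δ := by nlinarith [sq_nonneg δ]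
  have e : Real.log (4 * Real.pi * δ) - Real.log (2 * Real.pi * Real.sin (2 * δ)) =
      Real.log (2 * δ / Real.sin (2 * δ)) := by
    rw [← Real.log_div (by positivity) (by positivity)]
    congr 1
    field_simp
    ring
  have hge : 1 ≤ 2 * δ / Real.sin (2 * δ) := (one_le_div hs).2 hlt.le
  have hle : Real.log (2 * δ / Real.sin (2 * δ)) ≤ 2 * δ ^ 2 := by
    refine (Real.log_le_sub_one_of_pos (by positivity)).trans ?_
    rw [sub_le_iff_le_add, div_le_iff₀ hs]
    nlinarith [pow_pos h0 3, pow_pos h0 5, mul_pos (pow_pos h0 3) (show 0 < 1 / 2 - δ by linarith)]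
  rw [e, Real.norm_of_nonneg (div_nonneg (Real.log_nonneg hge) (by linarith)),
    div_le_iff₀ (by linarith)]
  nlinarith

/-- At δ = 0 the product is (c - log 2π - iπ/2)(-i)/(2π). Only the argument π/2 of the logarithm
survives in the real part. -/
lemma tendsto_re_mainTerm :
    Tendsto (fun δ : ℝ => 2 * Real.pi * (Complex.exp (-(δ * Complex.I)) *
      ((Real.eulerMascheroniConstant - ladderPoint δ) * Complex.exp (-ladderPoint δ))).re)
      (𝓝[>] 0) (𝓝 (-(Real.pi / 2))) := by
  have hc : Continuous fun δ : ℝ => 2 * Real.pi * (Complex.exp (-(δ * Complex.I)) *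
      ((Real.eulerMascheroniConstant - ladderPoint δ) * Complex.exp (-ladderPoint δ))).re := by
    unfold ladderPoint
    fun_prop
  refine (hc.tendsto' 0 _ ?_).mono_left nhdsWithin_le_nhds
  have h1 : Complex.exp (-ladderPoint 0) = -Complex.I / (2 * Real.pi) := by
    rw [Complex.exp_neg, ladderPoint, Complex.exp_add, exp_log_two_pi]
    have : Complex.exp (((Real.pi / 2 - 2 * 0 : ℝ) : ℂ) * Complex.I) = Complex.I := by
      rw [mul_zero, sub_zero]
      push_cast
      exact Complex.exp_pi_div_two_mul_I
    rw [this, mul_inv, Complex.inv_I]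
    ring
  have h2 : Complex.exp (-(((0 : ℝ) : ℂ) * Complex.I)) *
      ((Real.eulerMascheroniConstant - ladderPoint 0) * Complex.exp (-ladderPoint 0)) =
      ((1 / (2 * Real.pi) : ℝ) : ℂ) *
        ((Real.eulerMascheroniConstant - ladderPoint 0) * -Complex.I) := by
    rw [h1]
    push_cast
    simp
    ring
  rw [h2, Complex.re_ofReal_mul]
  have h3 : ((Real.eulerMascheroniConstant - ladderPoint 0) * -Complex.I).re = -(Real.pi / 2) := by
    simp [ladderPoint]
  rw [h3]
  have := Real.pi_ne_zero
  field_simp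

lemma re_exp_mul_I_mul (δ : ℝ) (z : ℂ) :
    (Complex.exp (-(δ * Complex.I)) * z).re = Real.cos δ * z.re + Real.sin δ * z.im := by
  have : Complex.exp (-(δ * Complex.I)) = (Real.cos δ : ℂ) - (Real.sin δ : ℂ) * Complex.I := by
    rw [← neg_mul, Complex.exp_mul_I, Complex.cos_neg, Complex.sin_neg, Complex.ofReal_cos,
      Complex.ofReal_sin]
    ring
  rw [this]
  simp only [Complex.mul_re, Complex.sub_re, Complex.ofReal_re, Complex.ofReal_im, Complex.I_re,
    Complex.I_im, Complex.sub_im, Complex.mul_im]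
  ring

/-- The Titchmarsh-Kober-Atkinson constant is `π`. -/
lemma isTitchmarshKoberAtkinsonConstant_pi : IsTitchmarshKoberAtkinsonConstant Real.pi := by
  have hu : Tendsto (fun δ : ℝ => 2 * Real.pi * Real.sin (2 * δ)) (𝓝[>] 0) (𝓝[>] 0) := by
    refine tendsto_nhdsWithin_iff.2 ⟨?_, ?_⟩
    · exact ((by fun_prop : Continuous fun δ : ℝ => 2 * Real.pi * Real.sin (2 * δ)).tendsto' 0 0
        (by simp)).mono_left nhdsWithin_le_nhds
    · filter_upwards [Ioo_mem_nhdsGT (show (0 : ℝ) < 1 / 2 by norm_num)] with δ hδ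
      exact hδ.1.trans_le (two_pi_mul_sin_ge hδ.1 hδ.2)
  have hcos : Tendsto (fun δ : ℝ => 2 * Real.pi * Real.cos δ) (𝓝[>] 0) (𝓝 (2 * Real.pi)) :=
    ((by fun_prop : Continuous fun δ : ℝ => 2 * Real.pi * Real.cos δ).tendsto' 0 _
      (by simp)).mono_left nhdsWithin_le_nhds
  have h := ((((hcos.mul tendsto_re_divisorSeries_sub).add
    (tendsto_sin_mul_im_divisorSeries.const_mul (2 * Real.pi))).add
    (hcos.mul (tendsto_realDivisorSeries_sub.comp hu))).add tendsto_log_sub_log_div_sin).sub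
    (tendsto_re_mainTerm.add tendsto_integral_reflectedPart)
  -- One π/2 comes from the constant 1/4 of the divisor series, the other from the main term at 2πi.
  have e : 2 * Real.pi * 0 + 2 * Real.pi * 0 + 2 * Real.pi * (1 / 4) + 0 - (-(Real.pi / 2) + 0) =
      Real.pi := by ring
  rw [e] at h
  refine h.congr' ?_
  filter_upwards [Ioo_mem_nhdsGT (show (0 : ℝ) < 1 / 2 by norm_num)] with δ hδ
  have h1 := integral_zetaSq_mul_exp_add hδ.1 (hδ.2.trans (by norm_num))
  rw [mul_sub, Complex.sub_re, re_exp_mul_I_mul δ (divisorSeries _)] at h1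
  have hs : 0 < Real.sin δ := Real.sin_pos_of_pos_of_lt_pi hδ.1 (by linarith [hδ.2, Real.pi_gt_three])
  have hc : 0 < Real.cos δ := Real.cos_pos_of_mem_Ioo
    ⟨by linarith [hδ.1, Real.pi_gt_three], by linarith [hδ.2, Real.pi_gt_three]⟩
  -- Since sin 2δ = 2 sin δ cos δ, the factor cos δ cancels and the denominator 2 sin δ of the
  -- definition appears exactly.
  have h2 : 2 * Real.pi * Real.cos δ * ((Real.eulerMascheroniConstant -
      Real.log (2 * Real.pi * Real.sin (2 * δ))) / (2 * Real.pi * Real.sin (2 * δ))) =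
      (Real.eulerMascheroniConstant - Real.log (2 * Real.pi * Real.sin (2 * δ))) /
        (2 * Real.sin δ) := by
    generalize Real.log (2 * Real.pi * Real.sin (2 * δ)) = l
    rw [Real.sin_two_mul]
    have := Real.pi_ne_zero
    field_simp
  simp only [Function.comp_apply]
  rw [mul_sub (2 * Real.pi * Real.cos δ) (realDivisorSeries _), h2, eq_sub_of_add_eq h1]
  ring

/-! ### From δ to y = 1/δ, and truncation at μ(y) -/

/-- Replacing 2 sin δ by 2δ changes the reciprocal by at most δ, which outweighs the logarithm. -/
lemma tendsto_mul_inv_sin_sub_inv :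
    Tendsto (fun δ : ℝ => (Real.eulerMascheroniConstant - Real.log (4 * Real.pi * δ)) *
      (1 / (2 * Real.sin δ) - 1 / (2 * δ))) (𝓝[>] 0) (𝓝 0) := by
  have hlim : Tendsto (fun δ : ℝ => |δ * (Real.eulerMascheroniConstant - Real.log (4 * Real.pi)) -
      δ * Real.log δ|) (𝓝[>] 0) (𝓝 0) := by
    have hc : Continuous fun δ : ℝ => |δ * (Real.eulerMascheroniConstant - Real.log (4 * Real.pi)) -
      δ * Real.log δ| := ((continuous_id.mul continuous_const).sub Real.continuous_mul_log).abs
    exact (hc.tendsto' 0 0 (by simp)).mono_left nhdsWithin_le_nhds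
  refine squeeze_zero_norm' ?_ hlim
  filter_upwards [Ioo_mem_nhdsGT (show (0 : ℝ) < 1 / 2 by norm_num)] with δ hδ
  have h0 := hδ.1
  have h1 := hδ.2
  have hlt := Real.sin_lt h0
  have hgt := Real.sin_gt_sub_cube h0
  have hs : δ / 2 ≤ Real.sin δ := by nlinarith [sq_nonneg δ]
  have hs0 : 0 < Real.sin δ := by linarith
  have h2 : 0 ≤ 1 / (2 * Real.sin δ) - 1 / (2 * δ) :=
    sub_nonneg.2 (one_div_le_one_div_of_le (by positivity) (by linarith))
  have h3 : 1 / (2 * Real.sin δ) - 1 / (2 * δ) ≤ δ := by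
    rw [sub_le_iff_le_add, div_le_iff₀ (by positivity)]
    have : (δ + 1 / (2 * δ)) * (2 * Real.sin δ) = 2 * δ * Real.sin δ + Real.sin δ / δ := by
      field_simp
    rw [this]
    have h4 : 1 - δ ^ 2 / 6 ≤ Real.sin δ / δ := by
      rw [le_div_iff₀ h0]
      nlinarith
    nlinarith
  rw [norm_mul, Real.norm_of_nonneg h2, Real.norm_eq_abs,
    Real.log_mul (by positivity) h0.ne']
  calc _ ≤ |Real.eulerMascheroniConstant - (Real.log (4 * Real.pi) + Real.log δ)| * δ := by gcongr
    _ = _ := by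
      nth_rewrite 2 [← abs_of_pos h0]
      rw [← abs_mul]
      ring_nf

/-- The full Laplace transform, whose truncation at `μ y` is `smoothed μ y`. -/
def laplaceZetaSq (y : ℝ) : ℝ := ∫ t in Ioi (0 : ℝ), zetaSq t * Real.exp (-(2 / y * t))

lemma tendsto_laplaceZetaSq_sub :
    Tendsto (fun y : ℝ => laplaceZetaSq y -
      y / 2 * (Real.eulerMascheroniConstant - Real.log (4 * Real.pi) + Real.log y)) atTop
      (𝓝 Real.pi) := by
  have h := (isTitchmarshKoberAtkinsonConstant_pi.add tendsto_mul_inv_sin_sub_inv).comp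
    tendsto_inv_atTop_nhdsGT_zero
  rw [add_zero] at h
  refine h.congr' ?_
  filter_upwards [eventually_gt_atTop 0] with y hy
  simp only [Function.comp_apply, laplaceZetaSq]
  rw [Real.log_mul (by positivity) (by positivity), Real.log_inv]
  simp only [div_eq_mul_inv]
  field_simp
  ring

variable {μ : ℝ → ℝ} {y₀ : ℝ}

lemma Admissible.pos (h : Admissible μ y₀) {y : ℝ} (hy : y₀ ≤ y) : 0 < μ y := by
  have h1 : 1 < y := h.one_lt.trans_le hy
  have := Real.log_pos h1
  exact lt_of_lt_of_le (by positivity) (h.lower_bound y hy)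

lemma smoothed_add_tail (h : Admissible μ y₀) {y : ℝ} (hy : y₀ ≤ y) :
    smoothed μ y + ∫ t in Ioi (μ y), zetaSq t * Real.exp (-(2 / y * t)) = laplaceZetaSq y := by
  have h0 : 0 < y := by linarith [h.one_lt]
  have hi := integrableOn_zetaSq_mul_exp (div_pos two_pos h0)
  exact intervalIntegral.integral_interval_add_Ioi hi
    (hi.mono_set (Ioi_subset_Ioi (h.pos hy).le))

lemma tail_nonneg (y : ℝ) : 0 ≤ ∫ t in Ioi (μ y), zetaSq t * Real.exp (-(2 / y * t)) :=
  setIntegral_nonneg measurableSet_Ioi fun t _ => mul_nonneg (zetaSq_nonneg t) (Real.exp_pos _).le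

/-- The weight e^{-2t/y} is split in two halves. Beyond 7y ln y one half is at most y^{-7}, which
pays for the powers of y lost when the other half absorbs the quadratic bound for |ζ|². -/
lemma tail_le (h : Admissible μ y₀) {y : ℝ} (hy : y₀ ≤ y) :
    ∫ t in Ioi (μ y), zetaSq t * Real.exp (-(2 / y * t)) ≤ 64 * Real.exp 1 / y := by
  have h1 : 1 < y := h.one_lt.trans_le hy
  have h0 : 0 < y := by linarith
  have hM := h.pos hy
  set K : ℝ := 32 * Real.exp 1 / y ^ 5 with hK
  have hb : ∀ t ∈ Ioi (μ y), zetaSq t * Real.exp (-(2 / y * t)) ≤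
      K * Real.exp (-(1 / (2 * y)) * t) := by
    intro t ht
    have ht : μ y < t := ht
    have ht0 : 0 < t := hM.trans ht
    have e1 : Real.exp (-(1 / y * t)) ≤ (y ^ 7)⁻¹ := by
      rw [← Real.exp_log (pow_pos h0 7), ← Real.exp_neg, Real.log_pow]
      refine Real.exp_le_exp.2 (neg_le_neg ?_)
      have := h.lower_bound y hy
      rw [one_div, inv_mul_eq_div, le_div_iff₀ h0]
      push_cast
      linarith
    have e2 := pow_mul_exp_neg_abs_le 2 (show 0 < 1 / y by positivity) t
    have e3 : Real.exp (1 / y / 2) ≤ Real.exp 1 := by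
      refine Real.exp_le_exp.2 ?_
      rw [div_div, div_le_one (by positivity)]
      linarith
    rw [abs_of_pos ht0] at e2
    have e4 := zetaSq_le t
    rw [abs_of_pos ht0] at e4
    calc zetaSq t * Real.exp (-(2 / y * t))
        = zetaSq t * Real.exp (-(1 / y * t)) * Real.exp (-(1 / y * t)) := by
          rw [mul_assoc, ← Real.exp_add]
          ring_nf
      _ ≤ (2 + 2 * t) ^ 2 * Real.exp (-(1 / y * t)) * (y ^ 7)⁻¹ := by gcongr
      _ ≤ (Nat.factorial 2 * (4 / (1 / y)) ^ 2 * Real.exp (1 / y / 2) *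
          Real.exp (-(1 / y / 2 * t))) * (y ^ 7)⁻¹ := by gcongr
      _ ≤ (Nat.factorial 2 * (4 / (1 / y)) ^ 2 * Real.exp 1 *
          Real.exp (-(1 / y / 2 * t))) * (y ^ 7)⁻¹ := by gcongr
      _ = K * Real.exp (-(1 / (2 * y)) * t) := by
        rw [hK, show -(1 / y / 2 * t) = -(1 / (2 * y)) * t by field_simp]
        simp only [Nat.factorial]
        field_simp
        norm_num
  have hneg : -(1 / (2 * y)) < 0 := neg_neg_of_pos (by positivity)
  have hint : IntegrableOn (fun t => K * Real.exp (-(1 / (2 * y)) * t)) (Ioi 0) :=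
    (integrableOn_exp_mul_Ioi hneg 0).const_mul K
  have hsub : Ioi (μ y) ⊆ Ioi 0 := Ioi_subset_Ioi hM.le
  calc _ ≤ ∫ t in Ioi (μ y), K * Real.exp (-(1 / (2 * y)) * t) :=
        setIntegral_mono_on ((integrableOn_zetaSq_mul_exp (div_pos two_pos h0)).mono_set hsub)
          (hint.mono_set hsub) measurableSet_Ioi hb
    _ ≤ ∫ t in Ioi 0, K * Real.exp (-(1 / (2 * y)) * t) :=
        setIntegral_mono_set hint (ae_of_all _ fun t => by positivity) hsub.eventuallyLE
    _ = 64 * Real.exp 1 / y ^ 4 := by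
        rw [integral_const_mul, integral_exp_mul_Ioi hneg, hK]
        simp
        field_simp
        norm_num
    _ ≤ _ := by
        gcongr
        exact le_self_pow₀ h1.le (by norm_num)

lemma tendsto_smoothed_sub (h : Admissible μ y₀) :
    Tendsto (fun y : ℝ => smoothed μ y -
      y / 2 * (Real.eulerMascheroniConstant - Real.log (4 * Real.pi) + Real.log y)) atTop
      (𝓝 Real.pi) := by
  have ht : Tendsto (fun y => ∫ t in Ioi (μ y), zetaSq t * Real.exp (-(2 / y * t))) atTop (𝓝 0) :=
    squeeze_zero' (Eventually.of_forall fun y => tail_nonneg y)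
      (by filter_upwards [eventually_ge_atTop y₀] with y hy using tail_le h hy)
      (tendsto_const_nhds.div_atTop tendsto_id)
  have h2 := tendsto_laplaceZetaSq_sub.sub ht
  rw [sub_zero] at h2
  refine h2.congr' ?_
  filter_upwards [eventually_ge_atTop y₀] with y hy
  rw [← smoothed_add_tail h hy]
  ring

/-! ### Solving the ladder equation -/

lemma tendsto_smoothed_atTop (h : Admissible μ y₀) : Tendsto (smoothed μ) atTop atTop := by
  have h1 : Tendsto (fun y : ℝ =>
      y / 2 * (Real.eulerMascheroniConstant - Real.log (4 * Real.pi) + Real.log y)) atTop atTop :=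
    (tendsto_id.atTop_div_const two_pos).atTop_mul_atTop₀
      (tendsto_atTop_add_const_left _ _ Real.tendsto_log_atTop)
  refine ((tendsto_smoothed_sub h).add_atTop h1).congr fun y => ?_
  ring

lemma hardyLittlewood_mono {a b : ℝ} (hab : a ≤ b) : hardyLittlewood a ≤ hardyLittlewood b := by
  have h1 := intervalIntegral.integral_interval_sub_left
    (continuous_zetaSq.intervalIntegrable (μ := volume) 0 b)
    (continuous_zetaSq.intervalIntegrable (μ := volume) 0 a)
  have h2 := intervalIntegral.integral_nonneg (μ := volume) hab fun t _ => zetaSq_nonneg t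
  rw [← h1] at h2
  exact sub_nonneg.1 h2

lemma continuous_hardyLittlewood : Continuous hardyLittlewood :=
  intervalIntegral.continuous_primitive (fun a b => continuous_zetaSq.intervalIntegrable a b) 0

lemma continuous_zetaSq_mul_exp (c : ℝ) : Continuous fun t => zetaSq t * Real.exp (-(c * t)) :=
  continuous_zetaSq.mul (by fun_prop)

/-- Increasing y raises the weight at each t > 0 and does not shorten the range. Strictness needs a
point where ζ does not vanish, found near t = 0. -/
lemma smoothed_strictMonoOn (h : Admissible μ y₀) : StrictMonoOn (smoothed μ) (Ici y₀) := by
  intro y₁ hy₁ y₂ hy₂ hlt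
  have hpos₁ : 0 < y₁ := by linarith [h.one_lt, mem_Ici.1 hy₁]
  have hM := h.pos hy₁
  have hdiv : 2 / y₂ < 2 / y₁ := div_lt_div_of_pos_left two_pos hpos₁ hlt
  obtain ⟨c, hc, hc2⟩ : ∃ c, 0 < zetaSq c ∧ c ∈ Ioo 0 (μ y₁) := by
    have h1 : ∀ᶠ c in 𝓝[>] (0 : ℝ), 0 < zetaSq c :=
      nhdsWithin_le_nhds (continuous_zetaSq.continuousAt.eventually (lt_mem_nhds zetaSq_zero_pos))
    exact (h1.and (Ioo_mem_nhdsGT hM)).exists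
  have h1 : smoothed μ y₁ < ∫ t in (0 : ℝ)..(μ y₁), zetaSq t * Real.exp (-(2 / y₂ * t)) := by
    refine intervalIntegral.integral_lt_integral_of_continuousOn_of_le_of_exists_lt hM
      (continuous_zetaSq_mul_exp _).continuousOn (continuous_zetaSq_mul_exp _).continuousOn
      (fun t ht => ?_) ⟨c, ⟨hc2.1.le, hc2.2.le⟩, ?_⟩
    · exact mul_le_mul_of_nonneg_left (Real.exp_le_exp.2
        (neg_le_neg (mul_le_mul_of_nonneg_right hdiv.le ht.1.le))) (zetaSq_nonneg t)
    · exact mul_lt_mul_of_pos_left (Real.exp_lt_exp.2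
        (neg_lt_neg (mul_lt_mul_of_pos_right hdiv hc2.1))) hc
  refine h1.trans_le ?_
  exact intervalIntegral.integral_mono_interval le_rfl hM.le (h.monotoneOn hy₁ hy₂ hlt.le)
    (ae_of_all _ fun t => mul_nonneg (zetaSq_nonneg t) (Real.exp_pos _).le)
    ((continuous_zetaSq_mul_exp _).intervalIntegrable _ _)

/-- The weight is at most 1, so the smoothed integral lies between J(0) = 0 and J(μ(y)), and the
intermediate value theorem applies. -/
lemma exists_hardyLittlewood_eq_smoothed (h : Admissible μ y₀) {y : ℝ} (hy : y₀ ≤ y) :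
    ∃ T, 0 ≤ T ∧ hardyLittlewood T = smoothed μ y := by
  have hM := h.pos hy
  have hpos : 0 < y := by linarith [h.one_lt]
  have h1 : 0 ≤ smoothed μ y := intervalIntegral.integral_nonneg hM.le fun t _ =>
    mul_nonneg (zetaSq_nonneg t) (Real.exp_pos _).le
  have h2 : smoothed μ y ≤ hardyLittlewood (μ y) := by
    refine intervalIntegral.integral_mono_on hM.le
      ((continuous_zetaSq_mul_exp _).intervalIntegrable _ _)
      (continuous_zetaSq.intervalIntegrable _ _) fun t ht => ?_
    refine mul_le_of_le_one_right (zetaSq_nonneg t) (Real.exp_le_one_iff.2 ?_)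
    have := ht.1
    have : 0 ≤ 2 / y * t := by positivity
    linarith
  have h3 : hardyLittlewood 0 = 0 := by simp [hardyLittlewood]
  obtain ⟨T, hT, he⟩ := intermediate_value_Icc hM.le continuous_hardyLittlewood.continuousOn
    (show smoothed μ y ∈ Icc (hardyLittlewood 0) (hardyLittlewood (μ y)) from ⟨h3.le.trans h1, h2⟩)
  exact ⟨T, hT.1, he⟩

lemma smoothed_phi {T : ℝ} (hT : T ∈ domain μ y₀) :
    phi μ y₀ T ∈ Ici y₀ ∧ smoothed μ (phi μ y₀ T) = hardyLittlewood T :=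
  ⟨Function.invFunOn_mem hT.2, Function.invFunOn_eq hT.2⟩

lemma phiOneInv_spec (h : Admissible μ y₀) {X : ℝ} (hX : y₀ / 2 ≤ X) :
    phiOneInv μ y₀ X ∈ domain μ y₀ ∧ phiOne μ y₀ (phiOneInv μ y₀ X) = X := by
  have hy : y₀ ≤ 2 * X := by linarith
  obtain ⟨T, hT0, hT⟩ := exists_hardyLittlewood_eq_smoothed h hy
  have hmem : T ∈ domain μ y₀ := ⟨hT0, 2 * X, hy, hT.symm⟩
  have hphi : phi μ y₀ T = 2 * X :=
    (smoothed_strictMonoOn h).injOn (smoothed_phi hmem).1 hy ((smoothed_phi hmem).2.trans hT)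
  have hex : ∃ T ∈ domain μ y₀, phiOne μ y₀ T = X := ⟨T, hmem, by rw [phiOne, hphi]; ring⟩
  exact ⟨Function.invFunOn_mem hex, Function.invFunOn_eq hex⟩

/-- Whichever preimage of X `phiOneInv` selects, this fixes its J-value, so injectivity of J is not
needed. -/
lemma hardyLittlewood_phiOneInv (h : Admissible μ y₀) {X : ℝ} (hX : y₀ / 2 ≤ X) :
    hardyLittlewood (phiOneInv μ y₀ X) = smoothed μ (2 * X) := by
  obtain ⟨h1, h2⟩ := phiOneInv_spec h hX
  rw [← (smoothed_phi h1).2]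
  congr 1
  rw [phiOne] at h2
  linarith

lemma tendsto_phiOneInv_atTop (h : Admissible μ y₀) : Tendsto (phiOneInv μ y₀) atTop atTop := by
  refine tendsto_atTop.2 fun B => ?_
  have h1 : Tendsto (fun X : ℝ => smoothed μ (2 * X)) atTop atTop :=
    (tendsto_smoothed_atTop h).comp (tendsto_id.const_mul_atTop two_pos)
  filter_upwards [h1.eventually_gt_atTop (hardyLittlewood B), eventually_ge_atTop (y₀ / 2)]
    with X hX1 hX2
  rw [← hardyLittlewood_phiOneInv h hX2] at hX1
  by_contra! hlt
  exact absurd (hardyLittlewood_mono hlt.le) (not_le.2 hX1)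

lemma tendsto_revIter_atTop (h : Admissible μ y₀) (r : ℕ) :
    Tendsto (revIter μ y₀ r) atTop atTop := by
  induction r with
  | zero => exact tendsto_id
  | succ r ih => exact (tendsto_phiOneInv_atTop h).comp ih

lemma eventually_revIter (h : Admissible μ y₀) (k : ℕ) :
    ∀ᶠ T : ℝ in atTop, ∀ r : ℕ, 1 ≤ r → r ≤ k →
      revIter μ y₀ r T ∈ domain μ y₀ ∧ phiOne μ y₀ (revIter μ y₀ r T) = revIter μ y₀ (r - 1) T := by
  have h1 : ∀ᶠ T : ℝ in atTop, ∀ n ∈ Finset.range k, y₀ / 2 ≤ revIter μ y₀ n T :=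
    (Finset.eventually_all _).2 fun n _ =>
      (tendsto_revIter_atTop h n).eventually_ge_atTop (y₀ / 2)
  filter_upwards [h1] with T hT r hr1 hrk
  obtain ⟨n, rfl⟩ : ∃ n, r = n + 1 := ⟨r - 1, by omega⟩
  exact phiOneInv_spec h (hT n (Finset.mem_range.2 (by omega)))

/-! ### The limit along the ladder -/

/-- The minus integrand is the negative of the plus integrand and the two sets partition (0, X], so
the sign condition drops out. -/
lemma integral_plusSet_sub_integral_minusSet {X : ℝ} (hX : 0 < X) :
    (∫ t in plusSet X, (Real.log t - zetaSq t)) - (∫ t in minusSet X, (-Real.log t + zetaSq t)) =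
      X * Real.log X - X - hardyLittlewood X := by
  set A : Set ℝ := {t | zetaSq t < Real.log t} with hA
  have hAm : MeasurableSet A := measurableSet_lt continuous_zetaSq.measurable Real.measurable_log
  have hp : plusSet X = Ioc 0 X ∩ A := by
    ext t
    simp only [plusSet, hA, mem_ofPred_eq, mem_inter_iff, mem_Ioc]
    tauto
  have hm : minusSet X = Ioc 0 X \ A := by
    ext t
    simp only [minusSet, hA, mem_ofPred_eq, Set.mem_sdiff, mem_Ioc, not_lt]
    tauto
  have hl : IntervalIntegrable Real.log volume 0 X := intervalIntegral.intervalIntegrable_log'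
  have hz : IntervalIntegrable zetaSq volume 0 X := continuous_zetaSq.intervalIntegrable _ _
  have hi : IntegrableOn (fun t => Real.log t - zetaSq t) (Ioc 0 X) :=
    (intervalIntegrable_iff_integrableOn_Ioc_of_le hX.le).1 (hl.sub hz)
  have h1 : ∫ t in minusSet X, (-Real.log t + zetaSq t) =
      -∫ t in minusSet X, (Real.log t - zetaSq t) := by
    rw [← integral_neg]
    congr 1
    ext t
    ring
  rw [h1, sub_neg_eq_add, hp, hm, integral_inter_add_sdiff hAm hi,
    ← intervalIntegral.integral_of_le hX.le, intervalIntegral.integral_sub hl hz, integral_log]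
  simp [hardyLittlewood]

lemma tendsto_ladder_defect (h : Admissible μ y₀) :
    Tendsto (fun X : ℝ => (∫ t in plusSet X, (Real.log t - zetaSq t))
      - (∫ t in minusSet X, (-Real.log t + zetaSq t))
      - (∫ t in X..(phiOneInv μ y₀ X), zetaSq t)
      - (Real.log (2 * Real.pi) - 1 - Real.eulerMascheroniConstant) * X)
      atTop (𝓝 (-Real.pi)) := by
  have h1 := ((tendsto_smoothed_sub h).comp (tendsto_id.const_mul_atTop two_pos)).neg
  refine h1.congr' ?_
  filter_upwards [eventually_ge_atTop (y₀ / 2), eventually_gt_atTop 0] with X hX hX0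
  have e1 : ∫ t in X..(phiOneInv μ y₀ X), zetaSq t =
      hardyLittlewood (phiOneInv μ y₀ X) - hardyLittlewood X :=
    (intervalIntegral.integral_interval_sub_left (continuous_zetaSq.intervalIntegrable _ _)
      (continuous_zetaSq.intervalIntegrable _ _)).symm
  -- At y = 2X the ln 2 inside ln 4π cancels the one in ln 2X, which leaves ln 2π in the linear
  -- term.
  have e2 : Real.log (4 * Real.pi) = Real.log 2 + Real.log (2 * Real.pi) := by
    rw [← Real.log_mul (by norm_num) (by positivity)]
    ring_nf
  rw [integral_plusSet_sub_integral_minusSet hX0, e1, hardyLittlewood_phiOneInv h hX]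
  simp only [Function.comp_apply, id]
  rw [e2, Real.log_mul two_ne_zero hX0.ne']
  ring

end

end JacobLadder

theorem theorem2 :
    ∃ c₀ : ℝ, JacobLadder.IsTitchmarshKoberAtkinsonConstant c₀ ∧
      ∀ (μ : ℝ → ℝ) (y₀ : ℝ), JacobLadder.Admissible μ y₀ → ∀ k : ℕ,
        (∀ᶠ T : ℝ in atTop, ∀ r : ℕ, 1 ≤ r → r ≤ k →
          JacobLadder.revIter μ y₀ r T ∈ JacobLadder.domain μ y₀ ∧
          JacobLadder.phiOne μ y₀ (JacobLadder.revIter μ y₀ r T) =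
            JacobLadder.revIter μ y₀ (r - 1) T) ∧
        ∀ r : ℕ, 1 ≤ r → r ≤ k →
          Tendsto (fun T : ℝ =>
              (∫ t in JacobLadder.plusSet (JacobLadder.revIter μ y₀ (r - 1) T),
                (Real.log t - JacobLadder.zetaSq t))
              - (∫ t in JacobLadder.minusSet (JacobLadder.revIter μ y₀ (r - 1) T),
                (-Real.log t + JacobLadder.zetaSq t))
              - (∫ t in (JacobLadder.revIter μ y₀ (r - 1) T)..(JacobLadder.revIter μ y₀ r T),
                JacobLadder.zetaSq t)
              - (Real.log (2 * Real.pi) - 1 - Real.eulerMascheroniConstant) *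
                JacobLadder.revIter μ y₀ (r - 1) T)
            atTop (𝓝 (-c₀)) := by
  refine ⟨Real.pi, JacobLadder.isTitchmarshKoberAtkinsonConstant_pi, fun μ y₀ h k =>
    ⟨JacobLadder.eventually_revIter h k, fun r hr _ => ?_⟩⟩
  obtain ⟨n, rfl⟩ : ∃ n, r = n + 1 := ⟨r - 1, by omega⟩
  -- Every r reduces to the same limit in X, taken along the previous iterate, which tends to
  -- infinity with T.
  exact (JacobLadder.tendsto_ladder_defect h).comp (JacobLadder.tendsto_revIter_atTop h n)
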